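/- Let $V$ be a finite-dimensional complex vector space (equipped with some norm), let $l,r\ge 0$ be integers, $D=\{z\in\mathbb C: |z|<1\}$ and $S^1=\partial D$. Let $\mathrm{Poly}^{l,r}_{V,S^1}$ be the space of polynomials $p(z)=\sum_{j=0}^l a_jz^j$, $a_j\in\mathrm{End}(V)$ (topologized as a subspace of $\mathrm{End}(V)^{l+1}$), such that $p(z)$ is invertible for all $z\in S^1$ and $\det p(z)$ has exactly $r$ roots in $D$, counted with multiplicity. *Configurations.* Let $\widetilde{\mathrm{Conf}}$ be the space of pairs $(A,\iota)\in M_r(\mathbb C)\times\mathrm{Hom}(V,\mathbb C^r)$ such that the eigenvalues of $A$ lie in $D$ and $(v_i)_i\mapsto\sum_{i=0}^{r-1}A^i\iota(v_i)$, $V^{\oplus r}\to\mathbb C^r$, is surjective. The group $GL_r(\mathbb C)$ acts by $g(A,\iota)=(gAg^{-1},g\iota)$; put $\mathrm{Conf}=GL_r(\mathbb C)\backslash\widetilde{\mathrm{Conf}}$ and $\mathcal E=\widetilde{\mathrm{Conf}}\times_{GL_r(\mathbb C)}\mathbb C^r\to\mathrm{Conf}$, with the fiberwise linear maps $A[A,\iota,v]=[A,\iota,Av]$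 on $\mathcal E$, $\iota([A,\iota],w)=[A,\iota,\iota w]$ from the trivial bundle $\underline V$ to $\mathcal E$, and $\pi=\sum_{i=0}^{r-1}A^i\iota:\underline V^{\oplus r}\to\mathcal E$. For $p\in\mathrm{Poly}^{l,r}_{V,S^1}$ let $\tilde p:\mathcal O_D(-;V)\to\mathcal O_D(-;V)$, $s\mapsto ps$, be the induced endomorphism of the sheaf of $V$-valued holomorphic functions on $D$. Choose an isomorphism $\varphi:H^0(D;\mathrm{Coker}\,\tilde p)\cong\mathbb C^r$ and let $\mathrm{conf}_D(p)=[A,\iota]$, where $A=\varphi\circ z\circ\varphi^{-1}$ and $\iota$ is the composition of $V\to\mathcal O_D(D;V)$ (constant functions), $\mathcal O_D(D;V)\to H^0(D;\mathrm{Coker}\,\tilde p)$ and $\varphi$. *Toeplitz operators.* For $p=\sum a_jz^j$ let $\bar p=\sum_{j=0}^l a_jS^j$ on $l^2(\mathbb Z_{\ge0};V)$, where $S$ is the shift $(v_0,v_1,\dots)\mapsto(0,v_0,v_1,\dots)$. **Statement.** The map $\mathrm{conf}_D:\mathrm{Poly}^{l,r}_{V,S^1}\to\mathrm{Conf}$ is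 well defined (such a $\varphi$ exists, $(A,\iota)\in\widetilde{\mathrm{Conf}}$, and the class $[A,\iota]$ does not depend on $\varphi$) and continuous. Let $X$ be a topological space and $f:X\to\mathrm{Poly}^{l,r}_{V,S^1}$ a continuous map. Then the family $\mathrm{Coker}\,\bar f=(\mathrm{Coker}\,\overline{f(x)})_{x\in X}$, with the quotient topology from $X\times l^2(\mathbb Z_{\ge0};V)$, and the pullback $\mathrm{Bun}_X(V,f)=(\mathrm{conf}_D\circ f)^*\mathcal E$ are complex vector bundles of rank $r$ over $X$, and they are naturally isomorphic: there is exactly one isomorphism of vector bundles $\Phi_f:\mathrm{Coker}\,\bar f\to\mathrm{Bun}_X(V,f)$ over $X$ whose composition with $\underline V^{\oplus r}\hookrightarrow\underline{l^2(\mathbb Z_{\ge0};V)}\to\mathrm{Coker}\,\bar f$, where the first map is $(v_0,\dots,v_{r-1})\mapsto(v_0,\dots,v_{r-1},0,0,\dots)$, is the pullback $\pi(f):\underline V^{\oplus r}\to\mathrm{Bun}_X(V,f)$ of $\pi$. On the fiber over $x$, if $\varphi:H^0(D;\mathrm{Coker}\,\widetilde{f(x)})\cong\mathbb C^r$ gives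 the configuration $(A,\iota)$, then $\Phi_f$ sends the class of $(v_n)_n$ to $[A,\iota,\varphi(h)]$, where $h$ is the class of the holomorphic function $\sum_n v_nz^n$ on $D$. Moreover, for every continuous map $g:Y\to X$, $\Phi_{f\circ g}$ is the pullback of $\Phi_f$ along $g$. -/

import Mathlib

open scoped Topology
open Bundle

noncomputable section

namespace BottConf

/-! ## Polynomials with coefficients in `End(V)` -/

section Polynomials

variable (V : Type*) [NormedAddCommGroup V] [NormedSpace ℂ V]

/-- The space `Poly_V^l` of polynomials `∑_{j ≤ l} a_j z^j` with `a_j ∈ End(V)`, topologized as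
`End(V)^{l+1}`. -/
abbrev PolyV (l : ℕ) : Type _ := Fin (l + 1) → (V →L[ℂ] V)

variable {V}

/-- The value `f(z) = ∑ a_j z^j ∈ End(V)`. -/
def PolyV.eval {l : ℕ} (p : PolyV V l) (z : ℂ) : V →L[ℂ] V := ∑ j : Fin (l + 1), z ^ (j : ℕ) • p j

/-- The polynomial `det f(z) ∈ ℂ[z]`, computed in a basis of `V`
(see `PolyV.eval_detPoly` for the independence of the basis). -/
def PolyV.detPoly [FiniteDimensional ℂ V] {l : ℕ} (p : PolyV V l) : Polynomial ℂ :=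
  Matrix.det (∑ j : Fin (l + 1), (Polynomial.X ^ (j : ℕ) : Polynomial ℂ) •
    (LinearMap.toMatrix (Module.finBasis ℂ V) (Module.finBasis ℂ V)
      (p j : V →ₗ[ℂ] V)).map Polynomial.C)

theorem PolyV.eval_detPoly [FiniteDimensional ℂ V] {l : ℕ} (p : PolyV V l) (z : ℂ) :
    p.detPoly.eval z = LinearMap.det (p.eval z : V →ₗ[ℂ] V) := by
  rw [← LinearMap.det_toMatrix (Module.finBasis ℂ V), PolyV.detPoly,
    ← Polynomial.coe_evalRingHom, RingHom.map_det]
  congr 1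
  ext i j
  simp [PolyV.eval, Matrix.sum_apply, LinearMap.toMatrix_apply]
  exact Finset.sum_congr rfl fun _ _ => mul_comm _ _

/-- The open unit disk. -/
abbrev disk : Set ℂ := Metric.ball 0 1

variable (V)

/-- The space `Poly_{V,S¹}^{l,r}` of those `f ∈ Poly_V^l` that are invertible on the unit circle and
for which `det f(z)` has exactly `r` roots, counted with multiplicity, in the open unit disk. -/
abbrev PolyS1 [FiniteDimensional ℂ V] (l r : ℕ) : Type _ :=
  {p : PolyV V l // (∀ z : ℂ, ‖z‖ = 1 → IsUnit (p.eval z)) ∧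
    p.detPoly.roots.countP (fun z => ‖z‖ < 1) = r}

end Polynomials

/-! ## Configuration spaces and the global section bundle -/

section Configurations

variable (V : Type*) [NormedAddCommGroup V] [NormedSpace ℂ V] (U : Set ℂ) (r : ℕ)

/-- The space of `V`-configurations `(A, ι)` of rank `r` over `U`: the eigenvalues of
`A ∈ M_r(ℂ)` lie in `U`, and `∑_{i < r} A^i ι : V^r → ℂ^r` is surjective. -/
abbrev ConfTilde : Type _ :=
  {a : Matrix (Fin r) (Fin r) ℂ × (V →L[ℂ] (Fin r → ℂ)) //
    spectrum ℂ a.1 ⊆ U ∧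
    Function.Surjective (fun v : Fin r → V => ∑ i : Fin r, (a.1 ^ (i : ℕ)).mulVec (a.2 (v i)))}

variable {V U r}

/-- `g · (A, ι) = (A', ι')`, where `g · (A, ι) = (g A g⁻¹, g ι)`. -/
def MovesTo (g : GL (Fin r) ℂ) (a b : ConfTilde V U r) : Prop :=
  b.1.1 = (g : Matrix (Fin r) (Fin r) ℂ) * a.1.1 * ((g⁻¹ : GL (Fin r) ℂ) : Matrix _ _ ℂ) ∧
    ∀ v, b.1.2 v = (g : Matrix (Fin r) (Fin r) ℂ).mulVec (a.1.2 v)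

theorem MovesTo.refl (a : ConfTilde V U r) : MovesTo 1 a a := by
  simp [MovesTo]

theorem MovesTo.symm {g : GL (Fin r) ℂ} {a b : ConfTilde V U r} (h : MovesTo g a b) :
    MovesTo g⁻¹ b a := by
  refine ⟨?_, fun v => ?_⟩
  · rw [h.1, inv_inv]
    simp only [mul_assoc, Units.inv_mul, mul_one, Units.inv_mul_cancel_left]
  · rw [h.2 v, Matrix.mulVec_mulVec, Units.inv_mul, Matrix.one_mulVec]

theorem MovesTo.trans {g h : GL (Fin r) ℂ} {a b c : ConfTilde V U r} (hab : MovesTo g a b)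
    (hbc : MovesTo h b c) : MovesTo (h * g) a c := by
  refine ⟨?_, fun v => ?_⟩
  · rw [hbc.1, hab.1, mul_inv_rev]
    simp only [Units.val_mul, mul_assoc]
  · rw [hbc.2, hab.2, Matrix.mulVec_mulVec, Units.val_mul]

/-- The action of `GL_r(ℂ)` on configurations is free. -/
theorem MovesTo.eq_one {g : GL (Fin r) ℂ} {a : ConfTilde V U r} (h : MovesTo g a a) : g = 1 := by
  have hc : (g : Matrix (Fin r) (Fin r) ℂ) * a.1.1 = a.1.1 * g := by
    conv_rhs => rw [h.1]
    simp only [mul_assoc, Units.inv_mul, mul_one]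
  have hp : ∀ i : ℕ, (g : Matrix (Fin r) (Fin r) ℂ) * a.1.1 ^ i = a.1.1 ^ i * g := fun i =>
    ((show Commute (g : Matrix (Fin r) (Fin r) ℂ) a.1.1 from hc).pow_right i).eq
  ext1
  apply Matrix.ext_of_mulVec_single
  intro j
  obtain ⟨v, hv⟩ := a.2.2 (Pi.single j 1)
  rw [← hv, Units.val_one, Matrix.one_mulVec]
  dsimp only
  rw [Matrix.mulVec_sum]
  refine Finset.sum_congr rfl fun i _ => ?_
  rw [Matrix.mulVec_mulVec, hp, ← Matrix.mulVec_mulVec, ← h.2]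

/-- The orbit equivalence relation of `GL_r(ℂ)` on configurations. -/
instance confSetoid : Setoid (ConfTilde V U r) where
  r a b := ∃ g, MovesTo g a b
  iseqv := ⟨fun a => ⟨1, .refl a⟩, fun ⟨g, h⟩ => ⟨g⁻¹, h.symm⟩,
    fun ⟨g, hg⟩ ⟨h, hh⟩ => ⟨h * g, hg.trans hh⟩⟩

/-- The orbit equivalence relation of `GL_r(ℂ)` on `ConfTilde × ℂ^r`, where
`g · (A, ι, v) = (g A g⁻¹, g ι, g v)`. -/
instance assocSetoid : Setoid (ConfTilde V U r × (Fin r → ℂ)) where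
  r x y := ∃ g, MovesTo g x.1 y.1 ∧ y.2 = (g : Matrix (Fin r) (Fin r) ℂ).mulVec x.2
  iseqv := by
    refine ⟨fun x => ⟨1, .refl _, by simp⟩, ?_, ?_⟩
    · rintro x y ⟨g, h, h'⟩
      exact ⟨g⁻¹, h.symm, by rw [h', Matrix.mulVec_mulVec, Units.inv_mul, Matrix.one_mulVec]⟩
    · rintro x y z ⟨g, hg, hg'⟩ ⟨h, hh, hh'⟩
      exact ⟨h * g, hg.trans hh, by rw [hh', hg', Matrix.mulVec_mulVec, Units.val_mul]⟩

variable (V U r)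

/-- The configuration space `Conf_{V,U}^r = GL_r(ℂ) \ ConfTilde`, with the quotient topology. -/
abbrev Conf : Type _ := Quotient (confSetoid (V := V) (U := U) (r := r))

/-- The total space `ConfTilde ×_{GL_r(ℂ)} ℂ^r` of the global section bundle, with the quotient
topology. -/
abbrev Assoc : Type _ := Quotient (assocSetoid (V := V) (U := U) (r := r))

variable {V U r}

/-- The class `[A, ι] ∈ Conf`. -/
def Conf.mk (a : ConfTilde V U r) : Conf V U r := Quotient.mk _ a

theorem Conf.mk_out (c : Conf V U r) : Conf.mk (Quotient.out c) = c := Quotient.out_eq c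

/-- The class `[A, ι, v]` in the total space of the global section bundle. -/
def Assoc.mk (a : ConfTilde V U r) (v : Fin r → ℂ) : Assoc V U r := Quotient.mk _ (a, v)

/-- The bundle projection `[A, ι, v] ↦ [A, ι]`. -/
def Assoc.proj : Assoc V U r → Conf V U r :=
  Quotient.map Prod.fst fun _ _ ⟨g, h, _⟩ => ⟨g, h⟩

theorem Assoc.proj_mk (a : ConfTilde V U r) (v : Fin r → ℂ) :
    (Assoc.mk a v).proj = Conf.mk a := rfl

theorem Assoc.mk_injective (a : ConfTilde V U r) : Function.Injective (Assoc.mk a) := by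
  intro v w h
  obtain ⟨g, h1, h2⟩ := Quotient.exact h
  have hg := h1.eq_one
  subst hg
  simpa using h2.symm

theorem Assoc.exists_mk (a : ConfTilde V U r) (e : Assoc V U r) (he : e.proj = Conf.mk a) :
    ∃ v, Assoc.mk a v = e := by
  induction e using Quotient.inductionOn with
  | h x =>
    obtain ⟨g, hg⟩ := Quotient.exact he
    refine ⟨(g : Matrix (Fin r) (Fin r) ℂ).mulVec x.2, ?_⟩
    exact Eq.symm (Quotient.sound (show x ≈ (a, _) from ⟨g, hg, rfl⟩))

variable (V U r)

/-- The fiber of the global section bundle over `c ∈ Conf_{V,U}^r`, with the subspace topology. -/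
def EFib (c : Conf V U r) : Type _ := {e : Assoc V U r // e.proj = c}

variable {V U r}

instance (c : Conf V U r) : TopologicalSpace (EFib V U r c) :=
  inferInstanceAs (TopologicalSpace {e : Assoc V U r // e.proj = c})

/-- The total space of the family of fibers has the topology of `ConfTilde ×_{GL_r(ℂ)} ℂ^r`. -/
instance : TopologicalSpace (TotalSpace (Fin r → ℂ) (EFib V U r)) :=
  TopologicalSpace.induced (fun e => (e.2.1 : Assoc V U r)) inferInstance

/-- The class `[A, ι, v]` in the fiber over `c = [A, ι]`. -/
def EFib.mk {c : Conf V U r} (a : ConfTilde V U r) (ha : Conf.mk a = c) (v : Fin r → ℂ) :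
    EFib V U r c := ⟨Assoc.mk a v, ha⟩

/-- The bijection `v ↦ [A, ι, v]` from `ℂ^r` to the fiber over `[A, ι]`. -/
def EFib.equiv {c : Conf V U r} (a : ConfTilde V U r) (ha : Conf.mk a = c) :
    (Fin r → ℂ) ≃ EFib V U r c :=
  Equiv.ofBijective (EFib.mk a ha) ⟨fun _ _ h => Assoc.mk_injective a (congrArg Subtype.val h),
    fun e => by
      obtain ⟨v, hv⟩ := Assoc.exists_mk a e.1 (e.2.trans ha.symm)
      exact ⟨v, Subtype.ext hv⟩⟩

/-- The vector space structure of the fiber over `c` is the one for which `v ↦ [A, ι, v]` is linear;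
it does not depend on the representative `(A, ι)` of `c`, see `EFib.mk_add` and `EFib.mk_smul`. -/
instance (c : Conf V U r) : AddCommGroup (EFib V U r c) :=
  (EFib.equiv c.out c.mk_out).symm.addCommGroup

instance (c : Conf V U r) : Module ℂ (EFib V U r c) :=
  (EFib.equiv c.out c.mk_out).symm.module ℂ

theorem EFib.mk_eq_mk {c : Conf V U r} {a b : ConfTilde V U r} (ha : Conf.mk a = c)
    (hb : Conf.mk b = c) : ∃ g : GL (Fin r) ℂ, MovesTo g a b ∧
      ∀ v, EFib.mk a ha v = EFib.mk b hb ((g : Matrix (Fin r) (Fin r) ℂ).mulVec v) := by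
  obtain ⟨g, hg⟩ := Quotient.exact (ha.trans hb.symm)
  exact ⟨g, hg, fun v => Subtype.ext (Quotient.sound ⟨g, hg, rfl⟩)⟩

theorem EFib.mk_add {c : Conf V U r} (a : ConfTilde V U r) (ha : Conf.mk a = c)
    (v w : Fin r → ℂ) : EFib.mk a ha (v + w) = EFib.mk a ha v + EFib.mk a ha w := by
  obtain ⟨g, -, hg⟩ := EFib.mk_eq_mk ha c.mk_out
  simp only [hg, Matrix.mulVec_add]
  change EFib.equiv c.out c.mk_out _ = EFib.equiv c.out c.mk_out
    ((EFib.equiv c.out c.mk_out).symm (EFib.equiv c.out c.mk_out _) +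
      (EFib.equiv c.out c.mk_out).symm (EFib.equiv c.out c.mk_out _))
  rw [Equiv.symm_apply_apply, Equiv.symm_apply_apply]

theorem EFib.mk_smul {c : Conf V U r} (a : ConfTilde V U r) (ha : Conf.mk a = c)
    (t : ℂ) (v : Fin r → ℂ) : EFib.mk a ha (t • v) = t • EFib.mk a ha v := by
  obtain ⟨g, -, hg⟩ := EFib.mk_eq_mk ha c.mk_out
  simp only [hg, Matrix.mulVec_smul]
  change EFib.equiv c.out c.mk_out _ = EFib.equiv c.out c.mk_out
    (t • (EFib.equiv c.out c.mk_out).symm (EFib.equiv c.out c.mk_out _))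
  rw [Equiv.symm_apply_apply]

theorem EFib.exists_mk {c : Conf V U r} (a : ConfTilde V U r) (ha : Conf.mk a = c)
    (e : EFib V U r c) : ∃ v, EFib.mk a ha v = e :=
  (EFib.equiv a ha).surjective e

/-- The bundle endomorphism `A`, given by `[A, ι, v] ↦ [A, ι, A v]`, on the total space. -/
def Assoc.opA : Assoc V U r → Assoc V U r :=
  Quotient.map (fun x => (x.1, x.1.1.1.mulVec x.2)) (by
    rintro ⟨a, v⟩ ⟨b, w⟩ ⟨g, h, h'⟩
    refine ⟨g, h, ?_⟩
    dsimp only at h h' ⊢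
    rw [h.1, h', Matrix.mulVec_mulVec, Matrix.mulVec_mulVec]
    simp only [mul_assoc, Units.inv_mul, mul_one])

/-- The bundle endomorphism `A` on the fiber over `c`. -/
def EFib.opA (c : Conf V U r) : EFib V U r c →ₗ[ℂ] EFib V U r c where
  toFun e := ⟨e.1.opA, by
    obtain ⟨v, rfl⟩ := EFib.exists_mk c.out c.mk_out e
    exact c.mk_out⟩
  map_add' e₁ e₂ := by
    obtain ⟨v, rfl⟩ := EFib.exists_mk c.out c.mk_out e₁
    obtain ⟨w, rfl⟩ := EFib.exists_mk c.out c.mk_out e₂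
    simp only [← EFib.mk_add]
    change EFib.mk c.out c.mk_out (c.out.1.1.mulVec (v + w)) =
      EFib.mk c.out c.mk_out (c.out.1.1.mulVec v) +
        EFib.mk c.out c.mk_out (c.out.1.1.mulVec w)
    rw [← EFib.mk_add, Matrix.mulVec_add]
  map_smul' t e := by
    obtain ⟨v, rfl⟩ := EFib.exists_mk c.out c.mk_out e
    simp only [← EFib.mk_smul]
    change EFib.mk c.out c.mk_out (c.out.1.1.mulVec (t • v)) =
      t • EFib.mk c.out c.mk_out (c.out.1.1.mulVec v)
    rw [← EFib.mk_smul, Matrix.mulVec_smul]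

theorem EFib.opA_mk {c : Conf V U r} (a : ConfTilde V U r) (ha : Conf.mk a = c)
    (v : Fin r → ℂ) : EFib.opA c (EFib.mk a ha v) = EFib.mk a ha (a.1.1.mulVec v) := rfl

/-- The bundle morphism `ι` from the trivial bundle `V`, given by `w ↦ [A, ι, ι w]`, on the fiber
over `c`; it does not depend on the representative `(A, ι)` of `c`, see `EFib.iota_eq`. -/
def EFib.iota (c : Conf V U r) : V →ₗ[ℂ] EFib V U r c where
  toFun w := EFib.mk c.out c.mk_out (c.out.1.2 w)
  map_add' w₁ w₂ := by rw [map_add, EFib.mk_add]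
  map_smul' t w := by rw [map_smul, EFib.mk_smul]; rfl

theorem EFib.iota_eq {c : Conf V U r} (a : ConfTilde V U r) (ha : Conf.mk a = c) (w : V) :
    EFib.iota c w = EFib.mk a ha (a.1.2 w) := by
  obtain ⟨g, h, hg⟩ := EFib.mk_eq_mk ha c.mk_out
  rw [hg, ← h.2]
  rfl

/-- The bundle morphism `π = ∑_{i < r} A^i ι` from the trivial bundle `V^r`, on the fiber
over `c`. -/
def EFib.piMap (c : Conf V U r) : (Fin r → V) →ₗ[ℂ] EFib V U r c :=
  ∑ i : Fin r, (EFib.opA c ^ (i : ℕ)) ∘ₗ EFib.iota c ∘ₗ LinearMap.proj i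

end Configurations

/-! ## The configuration map on the unit disk -/

section ConfigurationMap

variable {V : Type*} [NormedAddCommGroup V] [NormedSpace ℂ V]

variable (V) in
/-- Functions that are holomorphic near `x`. They represent the germs at `x` of `V`-valued
holomorphic functions. -/
def HolAt (x : ℂ) : Submodule ℂ (ℂ → V) where
  carrier := {h | ∀ᶠ z in 𝓝 x, DifferentiableAt ℂ h z}
  add_mem' h₁ h₂ := by
    filter_upwards [h₁, h₂] with z hz₁ hz₂ using hz₁.add hz₂
  zero_mem' := Filter.Eventually.of_forall fun z => differentiableAt_const (0 : V)
  smul_mem' c h hh := by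
    filter_upwards [hh] with z hz using hz.const_smul c

/-- Functions holomorphic near `x` whose germ at `x` is `f k` for a holomorphic germ `k` at `x`. -/
def stalkImage {l : ℕ} (p : PolyV V l) (x : ℂ) : Submodule ℂ (HolAt V x) where
  carrier := {h | ∃ k ∈ HolAt V x, ∀ᶠ z in 𝓝 x, h.1 z = p.eval z (k z)}
  add_mem' := by
    rintro h₁ h₂ ⟨k₁, hk₁, e₁⟩ ⟨k₂, hk₂, e₂⟩
    refine ⟨k₁ + k₂, add_mem hk₁ hk₂, ?_⟩
    filter_upwards [e₁, e₂] with z hz₁ hz₂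
    simp [hz₁, hz₂]
  zero_mem' := ⟨0, zero_mem _, by simp⟩
  smul_mem' := by
    rintro c h ⟨k, hk, e⟩
    refine ⟨c • k, Submodule.smul_mem _ c hk, ?_⟩
    filter_upwards [e] with z hz
    simp [hz]

/-- The stalk at `x` of the cokernel sheaf of `f~ : O(-; V) → O(-; V)`, `s ↦ f s`, that is, the
cokernel of `f` on germs at `x` of `V`-valued holomorphic functions. -/
abbrev CokerStalk {l : ℕ} (p : PolyV V l) (x : ℂ) : Type _ := HolAt V x ⧸ stalkImage p x

/-- The space `H⁰(Coker f~)` of global sections over the open unit disk of the cokernel sheaf of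
`f~ : O(-; V) → O(-; V)`, that is, of the sheafification of the presheaf cokernel: families of
elements of the stalks that are locally induced by a holomorphic function. -/
def H0 {l : ℕ} (p : PolyV V l) : Submodule ℂ (∀ x : disk, CokerStalk p x) where
  carrier := {s | ∀ x₀ : disk, ∃ t : ℂ → V, ∀ᶠ x : disk in 𝓝 x₀, ∃ ht : t ∈ HolAt V (x : ℂ),
    s x = Submodule.Quotient.mk ⟨t, ht⟩}
  add_mem' := by
    intro s₁ s₂ h₁ h₂ x₀
    obtain ⟨t₁, e₁⟩ := h₁ x₀
    obtain ⟨t₂, e₂⟩ := h₂ x₀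
    refine ⟨t₁ + t₂, ?_⟩
    filter_upwards [e₁, e₂] with x ⟨a₁, b₁⟩ ⟨a₂, b₂⟩
    exact ⟨add_mem a₁ a₂, by rw [Pi.add_apply, b₁, b₂, ← Submodule.Quotient.mk_add]; rfl⟩
  zero_mem' := fun x₀ => ⟨0, Filter.Eventually.of_forall fun x =>
    ⟨zero_mem _, (Submodule.Quotient.mk_zero _).symm⟩⟩
  smul_mem' := by
    intro c s h x₀
    obtain ⟨t, e⟩ := h x₀
    refine ⟨c • t, ?_⟩
    filter_upwards [e] with x ⟨a, b⟩
    exact ⟨Submodule.smul_mem _ c a, by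
      rw [Pi.smul_apply, b, ← Submodule.Quotient.mk_smul]; rfl⟩

/-- Multiplication by the coordinate `z` on functions holomorphic near `x`. -/
def mulZHol (x : ℂ) : HolAt V x →ₗ[ℂ] HolAt V x where
  toFun h := ⟨fun z => z • h.1 z, by
    filter_upwards [h.2] with z hz using differentiableAt_id.smul hz⟩
  map_add' h₁ h₂ := by ext z; simp
  map_smul' c h := by ext z; simp [smul_comm c]

/-- Multiplication by the coordinate `z` on the stalk of the cokernel sheaf at `x`. -/
def mulZStalk {l : ℕ} (p : PolyV V l) (x : ℂ) : CokerStalk p x →ₗ[ℂ] CokerStalk p x :=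
  Submodule.mapQ _ _ (mulZHol x) (by
    rintro h ⟨k, hk, e⟩
    refine ⟨_, (mulZHol x ⟨k, hk⟩).2, ?_⟩
    filter_upwards [e] with z hz
    simp [mulZHol, hz])

/-- Multiplication by the coordinate `z` on `H⁰(Coker f~)`. -/
def mulZ {l : ℕ} (p : PolyV V l) : H0 p →ₗ[ℂ] H0 p where
  toFun s := ⟨fun x => mulZStalk p x (s.1 x), by
    intro x₀
    obtain ⟨t, e⟩ := s.2 x₀
    refine ⟨fun z => z • t z, ?_⟩
    filter_upwards [e] with x ⟨a, b⟩
    exact ⟨(mulZHol (x : ℂ) ⟨t, a⟩).2, by rw [b]; rfl⟩⟩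
  map_add' s₁ s₂ := by ext x; simp
  map_smul' c s := by ext x; simp

variable (V) in
/-- `O(D; V)`: functions that are holomorphic on the open unit disk `D`. (Their values outside `D`
play no role.) -/
def HolDisk : Submodule ℂ (ℂ → V) where
  carrier := {h | DifferentiableOn ℂ h disk}
  add_mem' h₁ h₂ := DifferentiableOn.add h₁ h₂
  zero_mem' := differentiableOn_const (0 : V)
  smul_mem' c _ h := DifferentiableOn.const_smul h c

theorem HolDisk.holAt {h : ℂ → V} (hh : h ∈ HolDisk V) (x : disk) : h ∈ HolAt V (x : ℂ) := by
  filter_upwards [Metric.isOpen_ball.mem_nhds x.2] with z hz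
  exact hh.differentiableAt (Metric.isOpen_ball.mem_nhds hz)

/-- The canonical map `π : O(D; V) → H⁰(Coker f~)`. -/
def toH0 {l : ℕ} (p : PolyV V l) : HolDisk V →ₗ[ℂ] H0 p where
  toFun h := ⟨fun x => Submodule.Quotient.mk ⟨h.1, HolDisk.holAt h.2 x⟩,
    fun _ => ⟨h.1, Filter.Eventually.of_forall fun x => ⟨HolDisk.holAt h.2 x, rfl⟩⟩⟩
  map_add' _ _ := rfl
  map_smul' _ _ := rfl

variable (V) in
/-- The inclusion of `V` in `O(D; V)` as constant functions. -/
def constHol : V →ₗ[ℂ] HolDisk V where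
  toFun v := ⟨fun _ => v, differentiableOn_const v⟩
  map_add' _ _ := rfl
  map_smul' _ _ := rfl

/-- The configuration `(A, ι)` is the one obtained from `f` by the identification
`φ : H⁰(Coker f~) ≅ ℂ^r`: `A = φ z φ⁻¹` and `ι = φ π const`. -/
def Presents {l r : ℕ} (p : PolyV V l) (φ : H0 p ≃ₗ[ℂ] (Fin r → ℂ))
    (a : ConfTilde V disk r) : Prop :=
  (∀ s, φ (mulZ p s) = a.1.1.mulVec (φ s)) ∧ ∀ v, a.1.2 v = φ (toH0 p (constHol V v))

/-- `c = [A, ι]` for an `(A, ι)` obtained from `f` by some identification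
`φ : H⁰(Coker f~) ≅ ℂ^r`. -/
def IsConfOf {l r : ℕ} (p : PolyV V l) (c : Conf V disk r) : Prop :=
  ∃ (φ : H0 p ≃ₗ[ℂ] (Fin r → ℂ)) (a : ConfTilde V disk r), Presents p φ a ∧ Conf.mk a = c

theorem Conf.nonempty_of_polyS1 [FiniteDimensional ℂ V] {l r : ℕ} (p : PolyS1 V l r) :
    Nonempty (Conf V disk r) := by
  rcases Nat.eq_zero_or_pos r with rfl | hr
  · exact ⟨Conf.mk ⟨(0, 0), by simp [spectrum.of_subsingleton],
      fun w => ⟨0, Subsingleton.elim _ _⟩⟩⟩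
  have hV : Nontrivial V := by
    by_contra hV
    rw [not_nontrivial_iff_subsingleton] at hV
    have h0 : Module.finrank ℂ V = 0 := Module.finrank_zero_of_subsingleton
    have : IsEmpty (Fin (Module.finrank ℂ V)) := by rw [h0]; infer_instance
    have h1 : p.1.detPoly = 1 := Matrix.det_isEmpty
    have h2 := p.2.2
    rw [h1, Polynomial.roots_one] at h2
    simp at h2
    omega
  obtain ⟨v₀, hv₀⟩ := exists_ne (0 : V)
  obtain ⟨ψ, hψ⟩ := SeparatingDual.exists_eq_one (R := ℂ) hv₀
  let d : Fin r → ℂ := fun i => ((i : ℂ) + 2)⁻¹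
  have hd : Function.Injective d := by
    intro i j h
    simp only [d, inv_inj, add_left_inj, Nat.cast_inj] at h
    exact Fin.ext h
  refine ⟨Conf.mk ⟨(Matrix.diagonal d, ContinuousLinearMap.pi fun _ => ψ), ?_, ?_⟩⟩
  · dsimp only
    rw [spectrum_diagonal]
    rintro _ ⟨i, rfl⟩
    have : (2 : ℝ) ≤ ‖((i : ℂ) + 2)‖ := by
      have : ((i : ℂ) + 2) = (((i : ℕ) + 2 : ℕ) : ℂ) := by push_cast; rfl
      rw [this, Complex.norm_natCast]
      push_cast
      linarith [(Nat.cast_nonneg (i : ℕ) : (0 : ℝ) ≤ _)]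
    simp only [disk, Metric.mem_ball, dist_zero_right, d, norm_inv]
    exact inv_lt_one_of_one_lt₀ (by linarith)
  · intro w
    have hdet : IsUnit (Matrix.vandermonde d).det :=
      isUnit_iff_ne_zero.mpr (Matrix.det_vandermonde_ne_zero_iff.mpr hd)
    let c := (Matrix.vandermonde d)⁻¹.mulVec w
    have hc : (Matrix.vandermonde d).mulVec c = w := by
      simp only [c, Matrix.mulVec_mulVec]
      rw [Matrix.mul_nonsing_inv _ hdet, Matrix.one_mulVec]
    refine ⟨fun i => c i • v₀, ?_⟩
    rw [← hc]
    ext k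
    simp [Matrix.diagonal_pow, Matrix.mulVec, dotProduct,
      Matrix.vandermonde_apply, hψ, Matrix.diagonal_apply]

/-- The configuration map `conf_D : Poly_{V,S¹}^{l,r} → Conf_{V,D}^r` on the open unit disk `D`,
`f ↦ [φ z φ⁻¹, φ π const]` for any identification `φ : H⁰(Coker f~) ≅ ℂ^r`. -/
def confDisk [FiniteDimensional ℂ V] {l r : ℕ} (p : PolyS1 V l r) : Conf V disk r :=
  haveI := Conf.nonempty_of_polyS1 p
  Classical.epsilon (IsConfOf p.1)

end ConfigurationMap

/-! ## The Toeplitz operator -/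

section Toeplitz

variable (V : Type*) [NormedAddCommGroup V] [NormedSpace ℂ V]

/-- The space `l²(ℤ_{≥0}; V)`. -/
abbrev L2 : Type _ := lp (fun _ : ℕ => V) 2

variable {V}

theorem L2.summable (s : L2 V) : Summable fun n => ‖s n‖ ^ 2 := by
  have := (memℓp_gen_iff (p := 2) (by simp)).mp (lp.memℓp s)
  simpa using this

theorem L2.memℓp_of_summable {s : ℕ → V} (h : Summable fun n => ‖s n‖ ^ 2) :
    Memℓp (E := fun _ : ℕ => V) s 2 :=
  memℓp_gen (by simpa using h)

theorem L2.norm_sq (s : L2 V) : ‖s‖ ^ 2 = ∑' n, ‖s n‖ ^ 2 := by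
  have := lp.norm_rpow_eq_tsum (p := 2) (by simp) s
  simpa using this

/-- The sequence `(0, v₀, v₁, …)`. -/
def shiftFun (s : ℕ → V) : ℕ → V
  | 0 => 0
  | n + 1 => s n

theorem summable_shiftFun (s : L2 V) : Summable fun n => ‖shiftFun s n‖ ^ 2 :=
  (summable_nat_add_iff 1).mp (by simpa [shiftFun] using L2.summable s)

/-- The shift operator `S` on `l²(ℤ_{≥0}; V)`: `(S v)_0 = 0`, `(S v)_{n+1} = v_n`. -/
def shift : L2 V →L[ℂ] L2 V :=
  LinearMap.mkContinuous
    { toFun := fun s => ⟨shiftFun s, L2.memℓp_of_summable (summable_shiftFun s)⟩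
      map_add' := fun s t => by
        ext n
        cases n
        · exact (add_zero (0 : V)).symm
        · rfl
      map_smul' := fun c s => by
        ext n
        cases n <;> simp [shiftFun] }
    1 fun s => by
      rw [one_mul, ← sq_le_sq₀ (norm_nonneg _) (norm_nonneg _), L2.norm_sq, L2.norm_sq]
      refine le_of_eq ?_
      change ∑' n, ‖shiftFun s n‖ ^ 2 = _
      rw [(summable_shiftFun s).tsum_eq_zero_add]
      simp [shiftFun]

/-- The operator on `l²(ℤ_{≥0}; V)` that applies `a ∈ End(V)` to every entry. -/
def coeffOp (a : V →L[ℂ] V) : L2 V →L[ℂ] L2 V :=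
  have hb : ∀ (s : L2 V) (n : ℕ), ‖a (s n)‖ ^ 2 ≤ ‖a‖ ^ 2 * ‖s n‖ ^ 2 := fun s n => by
    rw [← mul_pow]
    exact pow_le_pow_left₀ (norm_nonneg _) (a.le_opNorm _) 2
  have hs : ∀ s : L2 V, Summable fun n => ‖a (s n)‖ ^ 2 := fun s =>
    Summable.of_nonneg_of_le (fun _ => by positivity) (hb s) ((L2.summable s).mul_left _)
  LinearMap.mkContinuous
    { toFun := fun s => ⟨fun n => a (s n), L2.memℓp_of_summable (hs s)⟩
      map_add' := fun s t => by
        ext n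
        exact map_add a (s n) (t n)
      map_smul' := fun c s => by
        ext n
        simp }
    ‖a‖ fun s => by
      rw [← sq_le_sq₀ (norm_nonneg _) (by positivity), mul_pow, L2.norm_sq, L2.norm_sq,
        ← tsum_mul_left]
      exact (hs s).tsum_le_tsum (hb s) ((L2.summable s).mul_left _)

/-- The Toeplitz operator `∑_j a_j S^j` on `l²(ℤ_{≥0}; V)`. -/
def toeplitz {l : ℕ} (p : PolyV V l) : L2 V →L[ℂ] L2 V :=
  ∑ j : Fin (l + 1), coeffOp (p j) ∘L shift ^ (j : ℕ)

/-- The cokernel of the Toeplitz operator, with the quotient topology. -/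
abbrev TCoker {l : ℕ} (p : PolyV V l) : Type _ := L2 V ⧸ (toeplitz p).range

/-- The projection `l²(ℤ_{≥0}; V) → Coker`. -/
abbrev toTCoker {l : ℕ} (p : PolyV V l) : L2 V →ₗ[ℂ] TCoker p := (toeplitz p).range.mkQ

/-- The inclusion `V^r → l²(ℤ_{≥0}; V)`, `(v_i) ↦ (v₀, …, v_{r-1}, 0, 0, …)`. -/
def inclL2 {r : ℕ} (v : Fin r → V) : L2 V := ∑ i : Fin r, lp.single 2 (i : ℕ) (v i)

theorem hardy_differentiableOn [FiniteDimensional ℂ V] (s : L2 V) :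
    DifferentiableOn ℂ (fun z : ℂ => ∑' n : ℕ, z ^ n • s n) disk := by
  have : CompleteSpace V := FiniteDimensional.complete ℂ V
  intro z hz
  obtain ⟨ρ, hρ, hρ'⟩ := exists_between (mem_ball_zero_iff.mp hz)
  have hρ0 : 0 ≤ ρ := (norm_nonneg z).trans hρ.le
  have := Complex.differentiableOn_tsum_of_summable_norm (F := fun (n : ℕ) (w : ℂ) => w ^ n • s n)
    (U := Metric.ball 0 ρ) (u := fun n => ρ ^ n * ‖s‖)
    ((summable_geometric_of_lt_one hρ0 hρ').mul_right _)
    (fun n => ((differentiable_id.pow n).smul_const _).differentiableOn) Metric.isOpen_ball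
    (fun n w hw => by
      rw [norm_smul, norm_pow]
      have := mem_ball_zero_iff.mp hw
      gcongr
      exact lp.norm_apply_le_norm (by simp) s n)
  exact (this.differentiableAt
    (Metric.isOpen_ball.mem_nhds (mem_ball_zero_iff.mpr hρ))).differentiableWithinAt

/-- The holomorphic function `∑_n v_n z^n ∈ O(D; V)` of a square-summable sequence `(v_n)`. -/
def hardy [FiniteDimensional ℂ V] (s : L2 V) : HolDisk V :=
  ⟨fun z => ∑' n : ℕ, z ^ n • s n, hardy_differentiableOn s⟩

end Toeplitz

/-! ## The two vector bundles -/

section Bundles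

/-- The family `E`, with its given topology on the total space, is a topological complex vector
bundle with fiber `F`. -/
def IsVectorBundle {B : Type*} [TopologicalSpace B] (F : Type*) [NormedAddCommGroup F]
    [NormedSpace ℂ F] (E : B → Type*) [∀ x, AddCommMonoid (E x)] [∀ x, Module ℂ (E x)]
    [∀ x, TopologicalSpace (E x)] [TopologicalSpace (TotalSpace F E)] : Prop :=
  ∃ _ : FiberBundle F E, VectorBundle ℂ F E

/-- An isomorphism over `B` of families of vector spaces: fiberwise linear isomorphisms that form a
homeomorphism of the total spaces. -/
structure BundleIso {B : Type*} (F : Type*) (E₁ E₂ : B → Type*)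
    [∀ x, AddCommMonoid (E₁ x)] [∀ x, Module ℂ (E₁ x)] [TopologicalSpace (TotalSpace F E₁)]
    [∀ x, AddCommMonoid (E₂ x)] [∀ x, Module ℂ (E₂ x)] [TopologicalSpace (TotalSpace F E₂)] where
  fib : ∀ x, E₁ x ≃ₗ[ℂ] E₂ x
  continuous_toFun : Continuous fun e : TotalSpace F E₁ => (⟨e.1, fib e.1 e.2⟩ : TotalSpace F E₂)
  continuous_invFun :
    Continuous fun e : TotalSpace F E₂ => (⟨e.1, (fib e.1).symm e.2⟩ : TotalSpace F E₁)

variable {V : Type*} [NormedAddCommGroup V] [NormedSpace ℂ V] [FiniteDimensional ℂ V]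
  {l r : ℕ} {X : Type*}

/-- The family of cokernels of the Toeplitz operators of a family `f` of polynomials. -/
def CokerBundle (f : X → PolyS1 V l r) (x : X) : Type _ := TCoker (f x).1

instance (f : X → PolyS1 V l r) (x : X) : AddCommGroup (CokerBundle f x) :=
  inferInstanceAs (AddCommGroup (TCoker (f x).1))

instance (f : X → PolyS1 V l r) (x : X) : Module ℂ (CokerBundle f x) :=
  inferInstanceAs (Module ℂ (TCoker (f x).1))

instance (f : X → PolyS1 V l r) (x : X) : TopologicalSpace (CokerBundle f x) :=
  inferInstanceAs (TopologicalSpace (TCoker (f x).1))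

/-- The projection `l²(ℤ_{≥0}; V) → Coker` over `x`. -/
def CokerBundle.mk (f : X → PolyS1 V l r) (x : X) : L2 V →ₗ[ℂ] CokerBundle f x :=
  toTCoker (f x).1

/-- The total space of the cokernel bundle is topologized as a quotient of `X × l²(ℤ_{≥0}; V)`. -/
instance [TopologicalSpace X] (f : X → PolyS1 V l r) :
    TopologicalSpace (TotalSpace (Fin r → ℂ) (CokerBundle f)) :=
  TopologicalSpace.coinduced
    (fun y : X × L2 V => (⟨y.1, CokerBundle.mk f y.1 y.2⟩ : TotalSpace (Fin r → ℂ) (CokerBundle f)))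
    inferInstance

/-- The bundle `Bun_X(V, f)`: the pullback along `conf_D ∘ f` of the global section bundle. -/
abbrev Bun (f : X → PolyS1 V l r) : X → Type _ := (fun x => confDisk (f x)) *ᵖ (EFib V disk r)

/-- The bundle morphism `π(f) = ∑_{i < r} A(f)^i ι(f) : V^r → Bun_X(V, f)` over `x`. -/
def Bun.piMap (f : X → PolyS1 V l r) (x : X) : (Fin r → V) →ₗ[ℂ] Bun f x :=
  EFib.piMap (confDisk (f x))

end Bundles

end BottConf

end

noncomputable section

namespace BottConf

/-! ### Entries of shifted and coefficientwise transformed sequences -/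

section Entries

variable {V : Type*} [NormedAddCommGroup V] [NormedSpace ℂ V]

/-! If a square-summable sequence is read as the holomorphic function `∑ v_n z^n` on `D`, the
Toeplitz operator of `p` becomes multiplication by `p`, so every sequence defines a global section
of the sheaf cokernel. The heart of the proof is that this map `hardyToH0` from `l²` to `H⁰` is
surjective and that its kernel is exactly the range of the Toeplitz operator. The two cokernels are
then the same space, of dimension `r`, and the fiberwise formula for the isomorphism is this
identification.

Dimension and kernel (`toepHom_fredholm`, `ker_hardyToH0`): at a root `x ∈ D` of the determinant the
symbol is divisible by an elementary factor `(1 - Q) + (z - x) Q` with `Q = ψ ⊗ w` a projection of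
rank one. The Toeplitz operator of this factor is injective, and its range is the hyperplane `ψ (h
x) = 0`. After `r` factors the remaining symbol is invertible on the closed disk; multiplying by the
adjugate reduces its Toeplitz operator to a polynomial in the shift, which is invertible because the
shift has norm at most one. The same induction shows that `h = p k` on `D` with `k` merely
continuous already puts the sequence in the range; no control of `k` at the boundary is needed.

Surjectivity (`exists_polySeq_hardyToH0`): by the adjugate again, germs divisible by `det p` lie in
the image of `p`. Hence only finitely many Taylor jets matter, and a polynomial function realizes
them. Cayley-Hamilton for multiplication by `z` on the `r`-dimensional space `H⁰` then leaves only
the generators `z^i V` with `i < r`. This makes `(A, ι)` a configuration, and since `V^r` also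
generates the Toeplitz cokernel, it forces uniqueness and base change.

Continuity (`exists_local_projection`): near `p₀` the Toeplitz operator, bordered by a fixed map
`ℂ^r → l²`, is invertible. Its inverse is norm continuous in `p` and provides a continuous
identification of the cokernel with `ℂ^r`, from which `(A, ι)` is read off. Finally, both bundles
are trivialized by the images of constant maps `k : ℂ^r → V^r`, and the isomorphism carries one
frame to the other. -/

theorem shift_zero (s : L2 V) : shift s 0 = 0 := rfl

theorem shift_succ (s : L2 V) (n : ℕ) : shift s (n + 1) = s n := rfl

theorem coeffOp_apply (a : V →L[ℂ] V) (s : L2 V) (n : ℕ) : coeffOp a s n = a (s n) := rfl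

end Entries

/-! ### Evaluation of Hardy functions at points of the disk -/

section HardyEval

variable {V : Type*} [NormedAddCommGroup V] [NormedSpace ℂ V] [FiniteDimensional ℂ V]

theorem summable_hardy {z : ℂ} (hz : ‖z‖ < 1) (s : L2 V) : Summable fun n : ℕ => z ^ n • s n := by
  have : CompleteSpace V := FiniteDimensional.complete ℂ V
  refine Summable.of_norm_bounded
    ((summable_geometric_of_lt_one (norm_nonneg z) hz).mul_right ‖s‖) fun n => ?_
  rw [norm_smul, norm_pow]
  gcongr
  exact lp.norm_apply_le_norm (by simp) s n

/-- The evaluation at `z ∈ D` of the holomorphic function of a square-summable sequence. -/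
def hardyAt {z : ℂ} (hz : ‖z‖ < 1) : L2 V →ₗ[ℂ] V where
  toFun s := ∑' n : ℕ, z ^ n • s n
  map_add' s t := by
    rw [← (summable_hardy hz s).tsum_add (summable_hardy hz t)]
    exact tsum_congr fun n => by simp
  map_smul' c s := by
    rw [RingHom.id_apply, ← (summable_hardy hz s).tsum_const_smul]
    exact tsum_congr fun n => by simp [smul_comm c]

theorem hardyAt_shift {z : ℂ} (hz : ‖z‖ < 1) (s : L2 V) :
    hardyAt hz (shift s) = z • hardyAt hz s := by
  change ∑' n : ℕ, z ^ n • shift s n = z • ∑' n : ℕ, z ^ n • s n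
  rw [(summable_hardy hz (shift s)).tsum_eq_zero_add, ← (summable_hardy hz s).tsum_const_smul]
  simp [shift_zero, shift_succ, pow_succ', mul_smul]

theorem hardyAt_coeffOp {z : ℂ} (hz : ‖z‖ < 1) (a : V →L[ℂ] V) (s : L2 V) :
    hardyAt hz (coeffOp a s) = a (hardyAt hz s) := by
  change ∑' n : ℕ, z ^ n • coeffOp a s n = a (∑' n : ℕ, z ^ n • s n)
  rw [a.map_tsum (summable_hardy hz s)]
  simp [coeffOp_apply]

theorem hardyAt_single_zero {z : ℂ} (hz : ‖z‖ < 1) (v : V) :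
    hardyAt hz (lp.single 2 0 v) = v := by
  change ∑' n : ℕ, z ^ n • lp.single (E := fun _ : ℕ => V) 2 0 v n = v
  rw [tsum_eq_single 0]
  · simp
  · intro n hn
    simp [lp.single_apply, hn]

end HardyEval

/-! ### Polynomial symbols, their Toeplitz operators and their values -/

section Symbols

variable (V : Type*) [NormedAddCommGroup V] [NormedSpace ℂ V]

/-- Coefficientwise application of endomorphisms, as a ring homomorphism. -/
def coeffHom : (V →L[ℂ] V) →+* (L2 V →L[ℂ] L2 V) where
  toFun := coeffOp
  map_one' := by ext s n; rfl
  map_mul' a b := by ext s n; rfl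
  map_zero' := by ext s n; rfl
  map_add' a b := by ext s n; rfl

variable {V}

/-- This commutation makes the substitution of `S` for `X` multiplicative, although the coefficients
in `End(V)` do not commute with each other. -/
theorem commute_coeffHom_shift (a : V →L[ℂ] V) : Commute (coeffHom V a) shift := by
  ext s n
  cases n
  · exact map_zero a
  · rfl

theorem coeffHom_smul (c : ℂ) (a : V →L[ℂ] V) : coeffHom V (c • a) = c • coeffHom V a := by
  ext s n
  rfl

variable (V) in
/-- The Toeplitz operator of a polynomial symbol, as a ring homomorphism. -/
def toepHom : Polynomial (V →L[ℂ] V) →+* (L2 V →L[ℂ] L2 V) :=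
  Polynomial.eval₂RingHom' (coeffHom V) shift commute_coeffHom_shift

variable (V) in
/-- Evaluation of a polynomial symbol at a complex number, as a ring homomorphism. -/
def evalHom (z : ℂ) : Polynomial (V →L[ℂ] V) →+* (V →L[ℂ] V) :=
  Polynomial.eval₂RingHom' (RingHom.id _) (algebraMap ℂ _ z)
    fun a => (Algebra.commutes z a).symm

@[simp] theorem toepHom_C (a : V →L[ℂ] V) : toepHom V (Polynomial.C a) = coeffHom V a :=
  Polynomial.eval₂_C _ _

@[simp] theorem toepHom_X : toepHom V Polynomial.X = shift :=
  Polynomial.eval₂_X _ _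

@[simp] theorem evalHom_C (z : ℂ) (a : V →L[ℂ] V) : evalHom V z (Polynomial.C a) = a :=
  Polynomial.eval₂_C _ _

@[simp] theorem evalHom_X (z : ℂ) : evalHom V z Polynomial.X = algebraMap ℂ _ z :=
  Polynomial.eval₂_X _ _

/-- The polynomial symbol `∑ a_j X^j`. -/
def PolyV.symbol {l : ℕ} (p : PolyV V l) : Polynomial (V →L[ℂ] V) :=
  ∑ j : Fin (l + 1), Polynomial.C (p j) * Polynomial.X ^ (j : ℕ)

theorem toepHom_symbol {l : ℕ} (p : PolyV V l) : toepHom V p.symbol = toeplitz p := by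
  simp only [PolyV.symbol, map_sum, map_mul, map_pow, toepHom_C, toepHom_X]
  rfl

theorem evalHom_symbol {l : ℕ} (p : PolyV V l) (z : ℂ) : evalHom V z p.symbol = p.eval z := by
  simp only [PolyV.symbol, map_sum, map_mul, map_pow, evalHom_C, evalHom_X, PolyV.eval]
  refine Finset.sum_congr rfl fun j _ => ?_
  rw [← map_pow, ← Algebra.commutes, ← Algebra.smul_def]

/-- The shift acts on functions as multiplication by `z` and coefficients act pointwise, so a
Toeplitz operator acts as multiplication by its symbol. -/
theorem hardyAt_toepHom [FiniteDimensional ℂ V] {z : ℂ} (hz : ‖z‖ < 1)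
    (P : Polynomial (V →L[ℂ] V)) (s : L2 V) :
    hardyAt hz (toepHom V P s) = evalHom V z P (hardyAt hz s) := by
  induction P using Polynomial.induction_on' generalizing s with
  | add P P' h h' => simp [h, h']
  | monomial n a =>
    rw [← Polynomial.C_mul_X_pow_eq_monomial]
    simp only [map_mul, map_pow, toepHom_C, toepHom_X, evalHom_C, evalHom_X]
    change hardyAt hz (coeffOp a ((shift ^ n) s)) = a _
    rw [hardyAt_coeffOp]
    congr 1
    induction n with
    | zero => simp
    | succ n ih =>
      rw [pow_succ', pow_succ']
      change hardyAt hz (shift ((shift ^ n) s)) = _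
      rw [hardyAt_shift, ih]
      simp [Algebra.algebraMap_eq_smul_one]

theorem differentiable_evalHom (P : Polynomial (V →L[ℂ] V)) :
    Differentiable ℂ fun z => evalHom V z P := by
  have : (fun z => evalHom V z P) = fun z => P.sum fun n a => a * (algebraMap ℂ _ z) ^ n := by
    ext1 z
    exact Polynomial.eval₂_eq_sum
  rw [this]
  simp only [Polynomial.sum, Algebra.algebraMap_eq_smul_one]
  fun_prop

/-- Division with remainder by `X - x` for symbols. -/
theorem exists_eq_X_sub_C_mul_add (P : Polynomial (V →L[ℂ] V)) (x : ℂ) :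
    ∃ K : Polynomial (V →L[ℂ] V),
      P = (Polynomial.X - Polynomial.C (algebraMap ℂ _ x)) * K + Polynomial.C (evalHom V x P) := by
  induction P using Polynomial.induction_on' with
  | add P P' h h' =>
    obtain ⟨K, hK⟩ := h
    obtain ⟨K', hK'⟩ := h'
    refine ⟨K + K', ?_⟩
    conv_lhs => rw [hK, hK']
    rw [map_add, map_add, mul_add]
    abel
  | monomial n a =>
    have hc : Commute (Polynomial.X : Polynomial (V →L[ℂ] V)) (Polynomial.C (algebraMap ℂ _ x)) :=
      Polynomial.X_mul
    -- The quotient comes from `X ^ n - x ^ n = (X - x) * ∑ X ^ i * x ^ (n - 1 - i)`; both `X` and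
    -- the scalar `x` commute with the coefficient `a`.
    refine ⟨(∑ i ∈ Finset.range n, Polynomial.X ^ i *
      Polynomial.C (algebraMap ℂ _ x) ^ (n - 1 - i)) * Polynomial.C a, ?_⟩
    rw [← mul_assoc, hc.mul_geom_sum₂, ← Polynomial.C_mul_X_pow_eq_monomial]
    simp only [map_mul, map_pow, evalHom_C, evalHom_X]
    rw [sub_mul, ← map_pow, ← map_pow, ← map_mul, Algebra.commutes (x ^ n) a, map_mul,
      Polynomial.X_pow_mul]
    abel

end Symbols

/-! ### The backward shift -/

section BackwardShift

variable (V : Type*) [NormedAddCommGroup V] [NormedSpace ℂ V]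

/-- The backward shift `(v₀, v₁, …) ↦ (v₁, v₂, …)`. -/
def backShift : L2 V →L[ℂ] L2 V :=
  LinearMap.mkContinuous
    { toFun := fun s => ⟨fun n => s (n + 1),
        L2.memℓp_of_summable ((summable_nat_add_iff 1).mpr (L2.summable s))⟩
      map_add' := fun s t => by ext n; rfl
      map_smul' := fun c s => by ext n; rfl }
    1 fun s => by
      rw [one_mul, ← sq_le_sq₀ (norm_nonneg _) (norm_nonneg _), L2.norm_sq, L2.norm_sq]
      change ∑' n, ‖s (n + 1)‖ ^ 2 ≤ _
      rw [(L2.summable s).tsum_eq_zero_add]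
      simp

variable {V}

theorem norm_backShift_le : ‖backShift V‖ ≤ 1 :=
  LinearMap.mkContinuous_norm_le _ zero_le_one _

theorem norm_shift_le : ‖(shift : L2 V →L[ℂ] L2 V)‖ ≤ 1 :=
  LinearMap.mkContinuous_norm_le _ zero_le_one _

theorem backShift_shift (s : L2 V) : backShift V (shift s) = s := by
  ext n
  rfl

theorem shift_backShift (s : L2 V) :
    shift (backShift V s) = s - lp.single 2 0 (s 0) := by
  ext n
  cases n with
  | zero => simp [shift_zero]
  | succ n =>
    rw [shift_succ]
    change s (n + 1) = s (n + 1) - lp.single (E := fun _ : ℕ => V) 2 0 (s 0) (n + 1)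
    simp [lp.single_apply]

theorem coeffHom_backShift (a : V →L[ℂ] V) (s : L2 V) :
    coeffHom V a (backShift V s) = backShift V (coeffHom V a s) := rfl

theorem coeffHom_shift (a : V →L[ℂ] V) (s : L2 V) :
    coeffHom V a (shift s) = shift (coeffHom V a s) :=
  DFunLike.congr_fun (commute_coeffHom_shift a).eq s

/-- `1 - x B` is surjective for `|x| < 1`. -/
theorem exists_sub_smul_backShift [CompleteSpace V] {x : ℂ} (hx : ‖x‖ < 1) (s : L2 V) :
    ∃ u : L2 V, u - x • backShift V u = s := by
  have h : ‖x • backShift V‖ < 1 := by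
    rw [norm_smul]
    calc ‖x‖ * ‖backShift V‖ ≤ ‖x‖ * 1 := by gcongr; exact norm_backShift_le
      _ < 1 := by simpa using hx
  -- Neumann series, available because the backward shift is a contraction.
  obtain ⟨w, hw⟩ := (isUnit_one_sub_of_norm_lt_one h).exists_right_inv
  refine ⟨w s, ?_⟩
  exact DFunLike.congr_fun hw s

/-- Applying the backward shift `B` gives `s = x • B s`, hence `‖s‖ ≤ ‖x‖ ‖s‖` with `‖x‖ < 1`. -/
theorem eq_zero_of_shift_eq_smul {x : ℂ} (hx : ‖x‖ < 1) {s : L2 V} (h : shift s = x • s) :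
    s = 0 := by
  have h1 : s = x • backShift V s := by rw [← map_smul, ← h, backShift_shift]
  have h2 : ‖s‖ ≤ ‖x‖ * ‖s‖ := by
    conv_lhs => rw [h1]
    rw [norm_smul]
    gcongr
    simpa using (backShift V).le_of_opNorm_le norm_backShift_le s
  have h3 : ‖s‖ = 0 := by nlinarith [norm_nonneg s]
  exact norm_eq_zero.mp h3

end BackwardShift

/-! ### Determinants, adjugates and invertible Toeplitz operators -/

section Invertible

variable {V : Type*} [NormedAddCommGroup V] [NormedSpace ℂ V] [FiniteDimensional ℂ V]

variable (V) in
/-- Endomorphisms of `V` as matrices. -/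
def endMatrix : (V →L[ℂ] V) ≃ₐ[ℂ]
    Matrix (Fin (Module.finrank ℂ V)) (Fin (Module.finrank ℂ V)) ℂ :=
  (Module.End.toContinuousLinearMap V).symm.trans
    (LinearMap.toMatrixAlgEquiv (Module.finBasis ℂ V))

theorem det_endMatrix (a : V →L[ℂ] V) :
    (endMatrix V a).det = LinearMap.det (a : V →ₗ[ℂ] V) :=
  LinearMap.det_toMatrix (Module.finBasis ℂ V) (a : V →ₗ[ℂ] V)

variable (V) in
/-- Polynomial symbols as matrices of polynomials. -/
def symbolMatrix : Polynomial (V →L[ℂ] V) ≃+*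
    Matrix (Fin (Module.finrank ℂ V)) (Fin (Module.finrank ℂ V)) (Polynomial ℂ) :=
  (Polynomial.mapEquiv (endMatrix V).toRingEquiv).trans matPolyEquiv.symm.toRingEquiv

theorem symbolMatrix_C (a : V →L[ℂ] V) :
    symbolMatrix V (Polynomial.C a) = (endMatrix V a).map Polynomial.C := by
  simp [symbolMatrix]

theorem symbolMatrix_X :
    symbolMatrix V Polynomial.X = algebraMap (Polynomial ℂ) _ Polynomial.X := by
  simp [symbolMatrix, Matrix.algebraMap_eq_diagonal, Matrix.diagonal]

/-- Both sides are ring homomorphisms in `P`, so constants and `X` suffice. -/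
theorem map_eval_symbolMatrix (z : ℂ) (P : Polynomial (V →L[ℂ] V)) :
    (symbolMatrix V P).map (Polynomial.eval z) = endMatrix V (evalHom V z P) := by
  have : ((Polynomial.evalRingHom z).mapMatrix.comp (symbolMatrix V).toRingHom) =
      (endMatrix V).toRingEquiv.toRingHom.comp (evalHom V z) := by
    refine Polynomial.ringHom_ext (fun a => ?_) ?_
    · ext i j
      simp [symbolMatrix_C]
    · ext i j
      simp [symbolMatrix_X, Matrix.algebraMap_matrix_apply, apply_ite (Polynomial.eval z)]
  exact RingHom.congr_fun this P

theorem eval_det_symbolMatrix (z : ℂ) (P : Polynomial (V →L[ℂ] V)) :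
    (symbolMatrix V P).det.eval z = LinearMap.det (evalHom V z P : V →ₗ[ℂ] V) := by
  rw [← det_endMatrix, ← map_eval_symbolMatrix, ← Polynomial.coe_evalRingHom, RingHom.map_det]
  rfl

/-- The adjugate symbol. -/
theorem exists_evalHom_mul_eq_det (P : Polynomial (V →L[ℂ] V)) :
    ∃ P' : Polynomial (V →L[ℂ] V), ∀ z (v : V), evalHom V z P (evalHom V z P' v) =
      LinearMap.det (evalHom V z P : V →ₗ[ℂ] V) • v := by
  refine ⟨(symbolMatrix V).symm (symbolMatrix V P).adjugate, fun z v => ?_⟩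
  have h : evalHom V z P * evalHom V z ((symbolMatrix V).symm (symbolMatrix V P).adjugate) =
      LinearMap.det (evalHom V z P : V →ₗ[ℂ] V) • 1 := by
    apply (endMatrix V).injective
    rw [map_mul, ← map_eval_symbolMatrix, ← map_eval_symbolMatrix, RingEquiv.apply_symm_apply,
      ← Polynomial.coe_evalRingHom, ← RingHom.mapMatrix_apply, ← RingHom.mapMatrix_apply, ← map_mul,
      Matrix.mul_adjugate, map_smul (endMatrix V), map_one, ← eval_det_symbolMatrix]
    ext i j
    by_cases hij : i = j <;> simp [hij]
  exact DFunLike.congr_fun h v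

/-- Scalar symbols give polynomials in the shift. This turns the matrix identity `P · adj P = det P`
into an operator identity. -/
theorem toepHom_symbolMatrix_symm (q : Polynomial ℂ) :
    toepHom V ((symbolMatrix V).symm (algebraMap _ _ q)) = Polynomial.aeval shift q := by
  have : ((toepHom V).comp (symbolMatrix V).symm.toRingHom).comp
      (algebraMap (Polynomial ℂ) (Matrix _ _ (Polynomial ℂ))) =
      (Polynomial.aeval (shift : L2 V →L[ℂ] L2 V)).toRingHom := by
    refine Polynomial.ringHom_ext (fun a => ?_) ?_
    · have h : (symbolMatrix V).symm (algebraMap _ _ (Polynomial.C a)) =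
          Polynomial.C (a • 1) := by
        rw [RingEquiv.symm_apply_eq, symbolMatrix_C, map_smul, map_one]
        ext i j : 2
        by_cases hij : i = j <;> simp [Matrix.algebraMap_matrix_apply, hij]
      change toepHom V ((symbolMatrix V).symm (algebraMap _ _ (Polynomial.C a))) =
        Polynomial.aeval (shift : L2 V →L[ℂ] L2 V) (Polynomial.C a)
      rw [h, toepHom_C, coeffHom_smul, map_one, Polynomial.aeval_C, Algebra.algebraMap_eq_smul_one]
    · change toepHom V ((symbolMatrix V).symm (algebraMap _ _ Polynomial.X)) =
        Polynomial.aeval (shift : L2 V →L[ℂ] L2 V) Polynomial.X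
      rw [← symbolMatrix_X, RingEquiv.symm_apply_apply, toepHom_X, Polynomial.aeval_X]
  exact RingHom.congr_fun this q

/-- Factor `q` into linear terms: if `q(S)` were not invertible, a root of `q` would lie in the
spectrum of `S`, hence in the closed unit disk because `‖S‖ ≤ 1`. -/
theorem isUnit_aeval_shift {q : Polynomial ℂ} (h : ∀ z : ℂ, ‖z‖ ≤ 1 → q.eval z ≠ 0) :
    IsUnit (Polynomial.aeval (shift : L2 V →L[ℂ] L2 V) q) := by
  have : CompleteSpace V := FiniteDimensional.complete ℂ V
  have hq : q ≠ 0 := fun h0 => h 0 (by simp) (by simp [h0])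
  rw [(IsAlgClosed.splits q).eq_prod_roots, map_mul, Polynomial.aeval_C]
  refine IsUnit.mul ((isUnit_iff_ne_zero.mpr (by simpa using hq)).map (algebraMap ℂ _)) ?_
  by_contra hu
  obtain ⟨k, hk, hk'⟩ := spectrum.exists_mem_of_not_isUnit_aeval_prod hu
  -- The spectral bound needs `‖1‖ = 1`; on the zero space the spectrum is empty.
  rcases subsingleton_or_nontrivial (L2 V) with hs | hs
  · simp at hk
  · exact h k ((spectrum.norm_le_norm_of_mem hk).trans norm_shift_le) hk'

/-- Toeplitz operators of symbols that are invertible on the closed unit disk are invertible. -/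
theorem toepHom_bijective {P : Polynomial (V →L[ℂ] V)}
    (h : ∀ z : ℂ, ‖z‖ ≤ 1 → LinearMap.det (evalHom V z P : V →ₗ[ℂ] V) ≠ 0) :
    Function.Bijective (toepHom V P) := by
  set m := symbolMatrix V P with hm
  have hu : IsUnit (Polynomial.aeval (shift : L2 V →L[ℂ] L2 V) m.det) :=
    isUnit_aeval_shift fun z hz => by
      rw [hm, eval_det_symbolMatrix]
      exact h z hz
  -- The operator of the adjugate symbol inverts that of `P` on both sides, up to the invertible
  -- operator `det P (S)`.
  have e1 : toepHom V P * toepHom V ((symbolMatrix V).symm m.adjugate) =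
      Polynomial.aeval shift m.det := by
    rw [← toepHom_symbolMatrix_symm, Algebra.algebraMap_eq_smul_one,
      ← Matrix.mul_adjugate, map_mul (symbolMatrix V).symm, map_mul (toepHom V), hm,
      RingEquiv.symm_apply_apply]
  have e2 : toepHom V ((symbolMatrix V).symm m.adjugate) * toepHom V P =
      Polynomial.aeval shift m.det := by
    rw [← toepHom_symbolMatrix_symm, Algebra.algebraMap_eq_smul_one,
      ← Matrix.adjugate_mul, map_mul (symbolMatrix V).symm, map_mul (toepHom V), hm,
      RingEquiv.symm_apply_apply]
  obtain ⟨u, hu⟩ := hu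
  rw [← hu] at e1 e2
  constructor
  · intro s t hst
    have h1 : ∀ s, u⁻¹.1 (toepHom V ((symbolMatrix V).symm m.adjugate) (toepHom V P s)) = s :=
      fun s => DFunLike.congr_fun (show u⁻¹.1 * (toepHom V ((symbolMatrix V).symm m.adjugate) *
        toepHom V P) = 1 by rw [e2, Units.inv_mul]) s
    rw [← h1 s, hst, h1 t]
  · intro s
    exact ⟨_, DFunLike.congr_fun (show toepHom V P *
      (toepHom V ((symbolMatrix V).symm m.adjugate) * u⁻¹.1) = 1 by
        rw [← mul_assoc, e1, Units.mul_inv]) s⟩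

end Invertible

/-! ### Splitting off an elementary factor at a root -/

section RankOneFactor

variable {V : Type*} [NormedAddCommGroup V] [NormedSpace ℂ V] [FiniteDimensional ℂ V]

/-- The elementary symbol `(1 - Q) + (X - x) Q`. -/
def elemSymbol (x : ℂ) (Q : V →L[ℂ] V) : Polynomial (V →L[ℂ] V) :=
  Polynomial.C (1 - Q) + (Polynomial.X - Polynomial.C (algebraMap ℂ _ x)) * Polynomial.C Q

omit [FiniteDimensional ℂ V] in
theorem evalHom_elemSymbol (x z : ℂ) (Q : V →L[ℂ] V) (v : V) :
    evalHom V z (elemSymbol x Q) v = v + (z - x - 1) • Q v := by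
  have : evalHom V z (elemSymbol x Q) = (1 - Q) + (algebraMap ℂ _ z - algebraMap ℂ _ x) * Q := by
    simp only [elemSymbol, map_add, map_mul, map_sub, evalHom_C, evalHom_X]
  rw [this]
  simp only [Algebra.algebraMap_eq_smul_one, ← sub_smul, smul_mul_assoc, one_mul]
  change v - Q v + (z - x) • Q v = _
  module

theorem det_evalHom_elemSymbol (x z : ℂ) {ψ : V →L[ℂ] ℂ} {w : V} (h : ψ w = 1) :
    LinearMap.det (evalHom V z (elemSymbol x (ψ.smulRight w)) : V →ₗ[ℂ] V) = z - x := by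
  -- The value is the transvection `v ↦ v + ψ v • (z - x - 1) w`, of determinant `1 + (z - x - 1) ψ
  -- w = z - x`.
  have : (evalHom V z (elemSymbol x (ψ.smulRight w)) : V →ₗ[ℂ] V) =
      LinearMap.transvection (ψ : V →ₗ[ℂ] ℂ) ((z - x - 1) • w) := by
    ext v
    simp only [ContinuousLinearMap.coe_coe, evalHom_elemSymbol, LinearMap.transvection.apply,
      ContinuousLinearMap.smulRight_apply]
    rw [smul_comm]
  rw [this, LinearMap.transvection.det]
  simp [h]

omit [FiniteDimensional ℂ V] in
theorem toepHom_elemSymbol (x : ℂ) (Q : V →L[ℂ] V) (s : L2 V) :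
    toepHom V (elemSymbol x Q) s =
      s - coeffHom V Q s + (shift (coeffHom V Q s) - x • coeffHom V Q s) := by
  have : toepHom V (elemSymbol x Q) = (1 - coeffHom V Q) + (shift - x • 1) * coeffHom V Q := by
    simp only [elemSymbol, map_add, map_mul, map_sub, map_one, toepHom_C, toepHom_X,
      Algebra.algebraMap_eq_smul_one, coeffHom_smul]
  rw [this]
  rfl

/-- A symbol that is singular at `x` is divisible by an elementary symbol. -/
theorem exists_eq_elemSymbol_mul {P : Polynomial (V →L[ℂ] V)} {x : ℂ}
    (h : LinearMap.det (evalHom V x P : V →ₗ[ℂ] V) = 0) :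
    ∃ (ψ : V →L[ℂ] ℂ) (w : V) (P' : Polynomial (V →L[ℂ] V)), ψ w = 1 ∧
      P = elemSymbol x (ψ.smulRight w) * P' := by
  have hr : LinearMap.range (evalHom V x P : V →ₗ[ℂ] V) < ⊤ := by
    rw [lt_top_iff_ne_top]
    intro ht
    have hb : IsUnit (evalHom V x P : V →ₗ[ℂ] V) := (LinearMap.isUnit_iff_range_eq_top _).mpr ht
    exact ((LinearMap.isUnit_iff_isUnit_det _).mp hb).ne_zero h
  -- A linear form that kills the image of `P(x)`, after normalization, gives a projection `Q` of
  -- rank one with `Q P(x) = 0`; hence `Q P = (X - x) K`.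
  obtain ⟨ψ₀, hψ₀, hle⟩ := Submodule.exists_le_ker_of_lt_top _ hr
  obtain ⟨w₀, hw₀⟩ : ∃ w, ψ₀ w ≠ 0 := by
    by_contra! hc
    exact hψ₀ (LinearMap.ext hc)
  let ψ : V →L[ℂ] ℂ := LinearMap.toContinuousLinearMap ψ₀
  let w : V := (ψ₀ w₀)⁻¹ • w₀
  have hw : ψ w = 1 := by
    change ψ₀ ((ψ₀ w₀)⁻¹ • w₀) = 1
    rw [map_smul, smul_eq_mul, inv_mul_cancel₀ hw₀]
  set Q : V →L[ℂ] V := ψ.smulRight w with hQ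
  have hQQ : Q * Q = Q := by
    ext v
    change ψ (ψ v • w) • w = ψ v • w
    rw [map_smul, hw, smul_eq_mul, mul_one]
  have hQP : Q * evalHom V x P = 0 := by
    ext v
    change ψ₀ (evalHom V x P v) • w = 0
    rw [show ψ₀ (evalHom V x P v) = 0 from hle ⟨v, rfl⟩, zero_smul]
  obtain ⟨K, hK⟩ := exists_eq_X_sub_C_mul_add (Polynomial.C Q * P) x
  rw [map_mul, evalHom_C, hQP, map_zero, add_zero] at hK
  set Y : Polynomial (V →L[ℂ] V) := Polynomial.X - Polynomial.C (algebraMap ℂ _ x) with hY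
  set q : Polynomial (V →L[ℂ] V) := Polynomial.C Q with hq
  have hqq : q * q = q := by rw [hq, ← map_mul, hQQ]
  have hqY : q * Y = Y * q := by
    rw [hY, hq, mul_sub, sub_mul, Polynomial.X_mul, ← map_mul, ← map_mul, Algebra.commutes]
  -- Multiplied by `(1 - Q) + (X - x) Q`, this quotient gives `(1 - Q) P + (X - x) Q K = (1 - Q) P +
  -- Q P = P`.
  refine ⟨ψ, w, (1 - q) * P + q * K, hw, ?_⟩
  rw [elemSymbol, ← hQ, ← hq, ← hY, map_sub, map_one, ← hq]
  have h1 : (1 - q) * (1 - q) = 1 - q := by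
    rw [mul_sub, mul_one, sub_mul, one_mul, hqq, sub_self, sub_zero]
  have h2 : (1 - q) * q = 0 := by rw [sub_mul, one_mul, hqq, sub_self]
  have h3 : q * (1 - q) = 0 := by rw [mul_sub, mul_one, hqq, sub_self]
  have h4 : Y * (q * K) = q * P := by rw [← mul_assoc, ← hqY, mul_assoc, ← hK, ← mul_assoc, hqq]
  calc P = (1 - q) * P + q * P := by rw [sub_mul, one_mul, sub_add_cancel]
    _ = ((1 - q) * (1 - q)) * P + ((1 - q) * q) * K + Y * ((q * (1 - q)) * P)
        + Y * ((q * q) * K) := by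
      rw [h1, h2, h3, hqq, h4, zero_mul, zero_mul, mul_zero, add_zero, add_zero]
    _ = _ := by simp only [add_mul, mul_add, mul_assoc]; abel

section Elementary

variable {x : ℂ} (hx : ‖x‖ < 1) {ψ : V →L[ℂ] ℂ} {w : V} (h : ψ w = 1)
include h hx

omit [FiniteDimensional ℂ V] in
-- Applying `Q` to `(1 - Q) s + (S - x) Q s = 0` leaves `S (Q s) = x • Q s`, so `Q s = 0`, and then
-- `s = 0`.
theorem toepHom_elemSymbol_injective :
    Function.Injective (toepHom V (elemSymbol x (ψ.smulRight w))) := by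
  rw [injective_iff_map_eq_zero]
  intro s hs
  set Q : V →L[ℂ] V := ψ.smulRight w with hQ
  have hQQ : ∀ t, coeffHom V Q (coeffHom V Q t) = coeffHom V Q t := by
    intro t
    ext n
    change ψ (ψ (t n) • w) • w = ψ (t n) • w
    rw [map_smul, h, smul_eq_mul, mul_one]
  rw [toepHom_elemSymbol] at hs
  have h1 := congrArg (coeffHom V Q) hs
  simp only [map_add, map_sub, map_smul, coeffHom_shift, hQQ, map_zero, sub_self, zero_add] at h1
  have h2 := eq_zero_of_shift_eq_smul hx (sub_eq_zero.mp h1)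
  simpa [h2] using hs

/-- The values at `x` of functions in the range lie in the image of `1 - Q`, which is `ker ψ`.
Conversely, if `ψ` kills the value at `x`, then `Q s` vanishes at `x` and can be divided by `z - x`
inside `l²`. -/
theorem range_toepHom_elemSymbol :
    LinearMap.range (toepHom V (elemSymbol x (ψ.smulRight w)) : L2 V →ₗ[ℂ] L2 V) =
      LinearMap.ker ((ψ : V →ₗ[ℂ] ℂ) ∘ₗ hardyAt hx) := by
  have : CompleteSpace V := FiniteDimensional.complete ℂ V
  set Q : V →L[ℂ] V := ψ.smulRight w with hQ
  have hQQ : ∀ t, coeffHom V Q (coeffHom V Q t) = coeffHom V Q t := by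
    intro t
    ext n
    change ψ (ψ (t n) • w) • w = ψ (t n) • w
    rw [map_smul, h, smul_eq_mul, mul_one]
  apply le_antisymm
  · rintro _ ⟨t, rfl⟩
    change ψ (hardyAt hx (toepHom V (elemSymbol x Q) t)) = 0
    rw [hardyAt_toepHom, evalHom_elemSymbol, hQ, ContinuousLinearMap.smulRight_apply]
    simp [h]
  · intro s hs
    have hs' : ψ (hardyAt hx s) = 0 := hs
    -- The quotient of `Q s` by `S - x` will be `B u`, where `u - x • B u = Q s`: indeed `(S - x) B
    -- u = Q s - u 0`, and evaluation at `x` shows `u 0 = 0`. Replacing `u₀` by `Q u₀` ensures `Q u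
    -- = u`.
    obtain ⟨u₀, hu₀⟩ := exists_sub_smul_backShift hx (coeffHom V Q s)
    set u := coeffHom V Q u₀ with hu
    have hQu : coeffHom V Q u = u := hQQ u₀
    have hu1 : u - x • backShift V u = coeffHom V Q s := by
      rw [← hQQ s, ← hu₀, map_sub, map_smul, coeffHom_backShift]
    have h3 : shift (backShift V u) - x • backShift V u =
        coeffHom V Q s - lp.single 2 0 (u 0) := by
      rw [shift_backShift, ← hu1]
      abel
    have h4 : u 0 = 0 := by
      have h5 := congrArg (hardyAt hx) h3
      rw [map_sub, map_sub, hardyAt_shift, map_smul, sub_self, hardyAt_single_zero] at h5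
      change 0 = hardyAt hx (coeffOp Q s) - _ at h5
      rw [hardyAt_coeffOp, hQ, ContinuousLinearMap.smulRight_apply, hs', zero_smul, zero_sub] at h5
      exact neg_eq_zero.mp h5.symm
    rw [h4, lp.single_zero, sub_zero] at h3
    refine ⟨s - coeffHom V Q s + backShift V u, ?_⟩
    change toepHom V (elemSymbol x Q) _ = s
    have h6 : coeffHom V Q (s - coeffHom V Q s + backShift V u) = backShift V u := by
      rw [map_add, map_sub, hQQ, sub_self, zero_add, coeffHom_backShift, hQu]
    rw [toepHom_elemSymbol, h6, h3]
    abel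

end Elementary

end RankOneFactor

/-- Cokernels of compositions: the codimensions add up. -/
theorem exists_ker_eq_range_comp {K M : Type*} [Field K] [AddCommGroup M] [Module K M] {r : ℕ}
    {f g : M →ₗ[K] M} (hf : Function.Injective f) {θ : M →ₗ[K] K} (hθ : Function.Surjective θ)
    (hfθ : LinearMap.range f = LinearMap.ker θ) {β : M →ₗ[K] (Fin r → K)}
    (hβ : Function.Surjective β) (hgβ : LinearMap.ker β = LinearMap.range g) :
    ∃ γ : M →ₗ[K] (Fin (r + 1) → K), Function.Surjective γ ∧
      LinearMap.ker γ = LinearMap.range (f ∘ₗ g) := by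
  obtain ⟨w, hw⟩ := hθ 1
  let e := LinearEquiv.ofInjective f hf
  -- The projection onto the range of `f` along `w`. The map sought is `s ↦ (θ s, β (f⁻¹ (pr s)))`.
  let pr : M →ₗ[K] LinearMap.range f := LinearMap.codRestrict _
    (LinearMap.id - θ.smulRight w) fun s => by rw [hfθ]; simp [hw]
  have hpr : ∀ s, f (e.symm (pr s)) = s - θ s • w := fun s =>
    congrArg Subtype.val (e.apply_symm_apply (pr s))
  have hpf : ∀ (t : M) (c : K), e.symm (pr (f t + c • w)) = t := fun t c => by
    have h0 : θ (f t) = 0 := by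
      rw [← LinearMap.mem_ker, ← hfθ]
      exact ⟨t, rfl⟩
    apply hf
    rw [hpr]
    simp [h0, hw]
  let γ : M →ₗ[K] (Fin (r + 1) → K) :=
    LinearMap.pi (Fin.cons θ fun i => LinearMap.proj i ∘ₗ β ∘ₗ e.symm.toLinearMap ∘ₗ pr)
  have hγ0 : ∀ s, γ s 0 = θ s := fun s => rfl
  have hγs : ∀ s (i : Fin r), γ s i.succ = β (e.symm (pr s)) i := fun s i => rfl
  refine ⟨γ, ?_, ?_⟩
  · intro y
    obtain ⟨t, ht⟩ := hβ (Fin.tail y)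
    have h0 : θ (f t) = 0 := by
      rw [← LinearMap.mem_ker, ← hfθ]
      exact ⟨t, rfl⟩
    refine ⟨f t + y 0 • w, ?_⟩
    ext i
    refine Fin.cases ?_ (fun i => ?_) i
    · rw [hγ0]
      simp [h0, hw]
    · rw [hγs, hpf, ht]
      rfl
  · ext s
    constructor
    · intro hs
      have hs' : γ s = 0 := hs
      have h0 : θ s = 0 := by rw [← hγ0, hs']; rfl
      have h1 : e.symm (pr s) ∈ LinearMap.ker β := by
        ext i
        rw [← hγs, hs']
        rfl
      rw [hgβ] at h1
      obtain ⟨t, ht⟩ := h1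
      refine ⟨t, ?_⟩
      rw [LinearMap.comp_apply, ht, hpr, h0, zero_smul, sub_zero]
    · rintro ⟨t, rfl⟩
      have h0 : θ (f (g t)) = 0 := by
        rw [← LinearMap.mem_ker, ← hfθ]
        exact ⟨g t, rfl⟩
      have h1 : β (g t) = 0 := by
        rw [← LinearMap.mem_ker, hgβ]
        exact ⟨t, rfl⟩
      change γ (f (g t)) = 0
      ext i
      refine Fin.cases ?_ (fun i => ?_) i
      · rw [hγ0, h0]
        rfl
      · have := hpf (g t) 0
        rw [zero_smul, add_zero] at this
        rw [hγs, this, h1]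
        rfl

/-! ### Index and range of the Toeplitz operators -/

section Fredholm

variable {V : Type*} [NormedAddCommGroup V] [NormedSpace ℂ V] [FiniteDimensional ℂ V]

/-- Induction on the number of roots in the disk: each elementary factor contributes one to the
codimension. The determinant enters as a polynomial `d` with the right values, so that it can be
divided by `X - x` along with the symbol. The last clause recognizes the range by a pointwise
quotient that is only continuous; it is what links the operator to the cokernel sheaf. -/
theorem toepHom_fredholm (r : ℕ) : ∀ (P : Polynomial (V →L[ℂ] V)) (d : Polynomial ℂ),
    (∀ z, LinearMap.det (evalHom V z P : V →ₗ[ℂ] V) = d.eval z) →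
    (∀ z : ℂ, ‖z‖ = 1 → d.eval z ≠ 0) →
    d.roots.countP (fun z => ‖z‖ < 1) = r →
    Function.Injective (toepHom V P) ∧
    (∃ β : L2 V →ₗ[ℂ] (Fin r → ℂ), Function.Surjective β ∧
      LinearMap.ker β = LinearMap.range (toepHom V P : L2 V →ₗ[ℂ] L2 V)) ∧
    ∀ (s : L2 V) (k : ℂ → V), ContinuousOn k disk →
      (∀ z (hz : ‖z‖ < 1), hardyAt hz s = evalHom V z P (k z)) → ∃ t, toepHom V P t = s := by
  induction r with
  | zero =>
    intro P d hd hd1 hr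
    have hd0 : d ≠ 0 := fun h => hd1 1 (by simp) (by simp [h])
    have hb : Function.Bijective (toepHom V P) := toepHom_bijective fun z hz => by
      rw [hd]
      rcases hz.lt_or_eq with hz | hz
      · intro h0
        exact Multiset.countP_eq_zero.mp hr z ((Polynomial.mem_roots hd0).mpr h0) hz
      · exact hd1 z hz
    refine ⟨hb.1, ⟨0, fun y => ⟨0, Subsingleton.elim _ _⟩, ?_⟩, fun s _ _ _ => hb.2 s⟩
    rw [LinearMap.ker_zero, eq_comm, LinearMap.range_eq_top]
    exact hb.2
  | succ r ih =>
    intro P d hd hd1 hr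
    have hd0 : d ≠ 0 := fun h => hd1 1 (by simp) (by simp [h])
    obtain ⟨x, hxr, hx⟩ := Multiset.countP_pos.mp (r.succ_pos.trans_eq hr.symm)
    have hdx : LinearMap.det (evalHom V x P : V →ₗ[ℂ] V) = 0 := by
      rw [hd]
      exact (Polynomial.mem_roots hd0).mp hxr
    obtain ⟨ψ, w, P', hw, rfl⟩ := exists_eq_elemSymbol_mul hdx
    obtain ⟨d', rfl⟩ := Polynomial.dvd_iff_isRoot.mpr ((Polynomial.mem_roots hd0).mp hxr)
    have hdet : ∀ z, (z - x) * LinearMap.det (evalHom V z P' : V →ₗ[ℂ] V) =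
        (z - x) * d'.eval z := fun z => by
      have h1 := hd z
      rw [map_mul] at h1
      change LinearMap.det ((evalHom V z (elemSymbol x (ψ.smulRight w)) : V →ₗ[ℂ] V) *
        (evalHom V z P' : V →ₗ[ℂ] V)) = _ at h1
      rw [map_mul, det_evalHom_elemSymbol x z hw] at h1
      simpa using h1
    have hd' : ∀ z, LinearMap.det (evalHom V z P' : V →ₗ[ℂ] V) = d'.eval z := by
      -- Pointwise cancellation of `z - x` fails at `z = x`, so the factor is cancelled between
      -- polynomials.
      have h2 : (Polynomial.X - Polynomial.C x) * (symbolMatrix V P').det =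
          (Polynomial.X - Polynomial.C x) * d' := Polynomial.funext fun z => by
        rw [Polynomial.eval_mul, Polynomial.eval_mul, eval_det_symbolMatrix]
        simpa using hdet z
      intro z
      rw [← eval_det_symbolMatrix, mul_left_cancel₀ (Polynomial.X_sub_C_ne_zero x) h2]
    have hd1' : ∀ z : ℂ, ‖z‖ = 1 → d'.eval z ≠ 0 := fun z hz h0 =>
      hd1 z hz (by rw [Polynomial.eval_mul, h0, mul_zero])
    have hr' : d'.roots.countP (fun z => ‖z‖ < 1) = r := by
      rw [Polynomial.roots_mul hd0, Polynomial.roots_X_sub_C, Multiset.countP_add] at hr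
      have : Multiset.countP (fun z : ℂ => ‖z‖ < 1) {x} = 1 := by
        rw [← Multiset.cons_zero, Multiset.countP_cons_of_pos
          (p := fun z : ℂ => ‖z‖ < 1) _ hx, Multiset.countP_zero]
      omega
    obtain ⟨hinj, ⟨β, hβ, hβk⟩, hk⟩ := ih P' d' hd' hd1' hr'
    have hEinj := toepHom_elemSymbol_injective hx hw
    refine ⟨?_, ?_, ?_⟩
    · rw [map_mul]
      exact hEinj.comp hinj
    · obtain ⟨γ, hγ, hγk⟩ := exists_ker_eq_range_comp
        (f := (toepHom V (elemSymbol x (ψ.smulRight w)) : L2 V →ₗ[ℂ] L2 V)) hEinj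
        (θ := (ψ : V →ₗ[ℂ] ℂ) ∘ₗ hardyAt hx)
        (fun c => ⟨lp.single 2 0 (c • w), by
          simp only [LinearMap.comp_apply, hardyAt_single_zero]
          simp [hw]⟩)
        (range_toepHom_elemSymbol hx hw) hβ hβk
      refine ⟨γ, hγ, ?_⟩
      rw [hγk, map_mul]
      rfl
    · intro s k hkc hsk
      have hs : s ∈ LinearMap.ker ((ψ : V →ₗ[ℂ] ℂ) ∘ₗ hardyAt hx) := by
        change ψ (hardyAt hx s) = 0
        rw [hsk x hx, map_mul, mul_apply_eq_comp, evalHom_elemSymbol]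
        simp [hw]
      rw [← range_toepHom_elemSymbol hx hw] at hs
      obtain ⟨t, rfl⟩ := hs
      have ht : ∀ z ∈ disk, z ≠ x → (hardy t).1 z = evalHom V z P' (k z) := by
        intro z hz hzx
        have hz' : ‖z‖ < 1 := mem_ball_zero_iff.mp hz
        have h1 := hsk z hz'
        change hardyAt hz' (toepHom V _ t) = _ at h1
        rw [hardyAt_toepHom, map_mul, mul_apply_eq_comp] at h1
        have h2 : IsUnit (evalHom V z (elemSymbol x (ψ.smulRight w)) : V →ₗ[ℂ] V) := by
          rw [LinearMap.isUnit_iff_isUnit_det, det_evalHom_elemSymbol x z hw, isUnit_iff_ne_zero]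
          exact sub_ne_zero.mpr hzx
        exact ((Module.End.isUnit_iff _).mp h2).1 h1
      have hev : Continuous fun z => evalHom V z P' := (differentiable_evalHom P').continuous
      have hc1 : ContinuousOn (hardy t).1 disk := (hardy_differentiableOn t).continuousOn
      have hc2 : ContinuousOn (fun z => evalHom V z P' (k z)) disk := hev.continuousOn.clm_apply hkc
      obtain ⟨u, hu⟩ := hk t k hkc fun z hz => by
        have hz' : z ∈ disk := mem_ball_zero_iff.mpr hz
        have hnz : disk ∈ 𝓝 z := Metric.isOpen_ball.mem_nhds hz'
        -- At `x` the elementary factor is singular and cannot be cancelled; both sides are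
        -- continuous, so the equality extends from a punctured neighborhood.
        by_cases hzx : z = x
        · have e1 : Filter.Tendsto (hardy t).1 (𝓝[≠] z) (𝓝 ((hardy t).1 z)) :=
            (hc1.continuousAt hnz).mono_left nhdsWithin_le_nhds
          have e2 : Filter.Tendsto (fun z => evalHom V z P' (k z)) (𝓝[≠] z)
              (𝓝 (evalHom V z P' (k z))) :=
            (hc2.continuousAt hnz).mono_left nhdsWithin_le_nhds
          refine tendsto_nhds_unique e1 (e2.congr' ?_)
          filter_upwards [self_mem_nhdsWithin, mem_nhdsWithin_of_mem_nhds hnz] with y hy hyd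
          exact (ht y hyd (hzx ▸ hy)).symm
        · exact ht z hz' hzx
      refine ⟨u, ?_⟩
      rw [map_mul]
      exact congrArg (toepHom V _) hu

end Fredholm

/-! ### Polynomial interpolation of germs -/

section PolynomialFunctions

variable (V : Type*) [NormedAddCommGroup V] [NormedSpace ℂ V]

/-- The `V`-valued polynomial functions. -/
def polyFun : Submodule ℂ (ℂ → V) :=
  Submodule.span ℂ (Set.range fun x : ℕ × V => fun z : ℂ => z ^ x.1 • x.2)

variable {V}

theorem const_mem_polyFun (v : V) : (fun _ => v) ∈ polyFun V :=
  Submodule.subset_span ⟨(0, v), by ext z; simp⟩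

theorem eval_smul_mem_polyFun (q : Polynomial ℂ) {g : ℂ → V} (hg : g ∈ polyFun V) :
    (fun z => q.eval z • g z) ∈ polyFun V := by
  induction hg using Submodule.span_induction with
  | mem g hg =>
    obtain ⟨⟨n, v⟩, rfl⟩ := hg
    induction q using Polynomial.induction_on' with
    | add q q' h h' =>
      convert add_mem h h' using 1
      ext z
      simp [add_smul]
    | monomial m c =>
      refine Submodule.subset_span ⟨(m + n, c • v), ?_⟩
      ext z
      simp only [Polynomial.eval_monomial, smul_smul]
      congr 1
      ring
  | zero =>
    convert zero_mem (polyFun V) using 1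
    ext z
    simp
  | add g g' _ _ h h' =>
    convert add_mem h h' using 1
    ext z
    simp
  | smul c g _ h =>
    convert Submodule.smul_mem _ c h using 1
    ext z
    simp [smul_comm c]

theorem polyFun_le_holDisk : polyFun V ≤ HolDisk V := by
  refine Submodule.span_le.mpr ?_
  rintro _ ⟨⟨n, v⟩, rfl⟩
  exact ((differentiable_id.pow n).smul_const v).differentiableOn

theorem polyFun_le_holAt (x : ℂ) : polyFun V ≤ HolAt V x := by
  refine Submodule.span_le.mpr ?_
  rintro _ ⟨⟨n, v⟩, rfl⟩
  exact Filter.Eventually.of_forall ((differentiable_id.pow n).smul_const v)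

theorem smul_mem_holAt {x : ℂ} {c : ℂ → ℂ} (hc : ∀ᶠ z in 𝓝 x, DifferentiableAt ℂ c z)
    {h : ℂ → V} (hh : h ∈ HolAt V x) : (fun z => c z • h z) ∈ HolAt V x := by
  filter_upwards [hc, hh] with z h1 h2 using h1.smul h2

theorem inv_eval_smul_mem_holAt {x : ℂ} {q : Polynomial ℂ} (hq : q.eval x ≠ 0) {h : ℂ → V}
    (hh : h ∈ HolAt V x) : (fun z => (q.eval z)⁻¹ • h z) ∈ HolAt V x := by
  refine smul_mem_holAt ?_ hh
  filter_upwards [q.continuous.continuousAt.eventually_ne hq] with z hz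
  exact q.differentiable.differentiableAt.inv hz

/-- Removable singularity: the difference quotient stays holomorphic at `x`. -/
theorem dslope_mem_holAt [CompleteSpace V] {x : ℂ} {h : ℂ → V} (hh : h ∈ HolAt V x) :
    dslope h x ∈ HolAt V x := by
  obtain ⟨s, hs, hso, hxs⟩ := mem_nhds_iff.mp hh
  have h1 : DifferentiableOn ℂ (dslope h x) s :=
    (Complex.differentiableOn_dslope (hso.mem_nhds hxs)).mpr
      fun z hz => (hs hz : DifferentiableAt ℂ h z).differentiableWithinAt
  filter_upwards [hso.mem_nhds hxs] with z hz
  exact h1.differentiableAt (hso.mem_nhds hz)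

/-- Taylor expansion with remainder. -/
theorem exists_taylor [CompleteSpace V] {x : ℂ} {h : ℂ → V} (hh : h ∈ HolAt V x) (m : ℕ) :
    ∃ T ∈ polyFun V, ∃ R ∈ HolAt V x, ∀ z, h z = T z + (z - x) ^ m • R z := by
  induction m with
  | zero => exact ⟨0, zero_mem _, h, hh, fun z => by simp⟩
  | succ m ih =>
    obtain ⟨T, hT, R, hR, e⟩ := ih
    -- From `R z = R x + (z - x) • dslope R x z`.
    refine ⟨T + fun z => ((Polynomial.X - Polynomial.C x) ^ m).eval z • R x,
      add_mem hT (eval_smul_mem_polyFun _ (const_mem_polyFun _)),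
      dslope R x, dslope_mem_holAt hR, fun z => ?_⟩
    rw [e z, pow_succ, mul_smul, sub_smul_dslope]
    simp only [Pi.add_apply, Polynomial.eval_pow, Polynomial.eval_sub, Polynomial.eval_X,
      Polynomial.eval_C, smul_sub]
    abel

/-- Functions whose germ at `x` is `d` times a holomorphic germ. -/
def germMultiples (d : Polynomial ℂ) (x : ℂ) : Submodule ℂ (ℂ → V) where
  carrier := {h | ∃ k ∈ HolAt V x, ∀ᶠ z in 𝓝 x, h z = d.eval z • k z}
  add_mem' := by
    rintro h₁ h₂ ⟨k₁, hk₁, e₁⟩ ⟨k₂, hk₂, e₂⟩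
    refine ⟨k₁ + k₂, add_mem hk₁ hk₂, ?_⟩
    filter_upwards [e₁, e₂] with z hz₁ hz₂
    simp [hz₁, hz₂]
  zero_mem' := ⟨0, zero_mem _, by simp⟩
  smul_mem' := by
    rintro c h ⟨k, hk, e⟩
    refine ⟨c • k, Submodule.smul_mem _ c hk, ?_⟩
    filter_upwards [e] with z hz
    simp [hz, smul_comm c]

theorem mem_germMultiples_of_eval_ne_zero {d : Polynomial ℂ} {x : ℂ} (hd : d.eval x ≠ 0)
    {h : ℂ → V} (hh : h ∈ HolAt V x) : h ∈ germMultiples d x := by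
  refine ⟨_, inv_eval_smul_mem_holAt hd hh, ?_⟩
  filter_upwards [d.continuous.continuousAt.eventually_ne hd] with z hz
  rw [smul_inv_smul₀ hz]

/-- A germ is matched modulo `d` by a polynomial function that vanishes modulo `d` at all
other points. -/
theorem exists_polyFun_sub_mem_germMultiples [CompleteSpace V] {d : Polynomial ℂ} (hd : d ≠ 0)
    {x : ℂ} {t : ℂ → V} (ht : t ∈ HolAt V x) :
    ∃ g ∈ polyFun V, t - g ∈ germMultiples d x ∧ ∀ y ≠ x, g ∈ germMultiples d y := by
  obtain ⟨q, hq, hqx⟩ := Polynomial.exists_eq_pow_rootMultiplicity_mul_and_not_dvd d hd x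
  set m := d.rootMultiplicity x
  rw [Polynomial.dvd_iff_isRoot] at hqx
  have hev : ∀ z, d.eval z = (z - x) ^ m * q.eval z := fun z => by
    conv_lhs => rw [hq]
    simp
  obtain ⟨T, hT, R, hR, e⟩ := exists_taylor ht m
  have hco : IsCoprime ((Polynomial.X - Polynomial.C x) ^ m) q := by
    refine IsCoprime.pow_left ?_
    rw [(Polynomial.irreducible_X_sub_C x).coprime_iff_not_dvd, Polynomial.dvd_iff_isRoot]
    exact hqx
  obtain ⟨a, b, hab⟩ := hco
  have hab' : ∀ z, b.eval z * q.eval z = 1 - a.eval z * (z - x) ^ m := fun z => by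
    have := congrArg (Polynomial.eval z) hab
    simp only [Polynomial.eval_add, Polynomial.eval_mul, Polynomial.eval_pow, Polynomial.eval_sub,
      Polynomial.eval_X, Polynomial.eval_C, Polynomial.eval_one] at this
    linear_combination this
  -- Here `d = (X - x)^m q` and `a (X - x)^m + b q = 1`. The function `b q T` agrees with `T` modulo
  -- `(z - x)^m`, and it is a multiple of `q`, hence of `d` wherever `z - x` is invertible.
  refine ⟨fun z => (b * q).eval z • T z, eval_smul_mem_polyFun _ hT, ?_, fun y hy => ?_⟩
  · refine ⟨fun z => (q.eval z)⁻¹ • (R z + a.eval z • T z),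
      inv_eval_smul_mem_holAt hqx (add_mem hR (polyFun_le_holAt x (eval_smul_mem_polyFun a hT))),
      ?_⟩
    filter_upwards [q.continuous.continuousAt.eventually_ne hqx] with z hz
    rw [hev, mul_smul, smul_inv_smul₀ hz, Pi.sub_apply, e z, Polynomial.eval_mul, hab']
    module
  · have hyx : ((Polynomial.X - Polynomial.C x) ^ m).eval y ≠ 0 := by
      simpa using fun h => absurd (sub_eq_zero.mp h) hy
    refine ⟨_, inv_eval_smul_mem_holAt hyx
      (polyFun_le_holAt y (eval_smul_mem_polyFun b hT)), ?_⟩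
    filter_upwards [((Polynomial.X - Polynomial.C x) ^ m).continuous.continuousAt.eventually_ne
      hyx] with z hz
    have h1 : d.eval z = q.eval z * ((Polynomial.X - Polynomial.C x) ^ m).eval z := by
      rw [hev]
      simp [mul_comm]
    rw [h1, mul_smul, smul_inv_smul₀ hz, Polynomial.eval_mul, mul_comm, mul_smul]

/-- Chinese remaindering: the one-point solutions are summed over the roots of `d`. At any other
point `d` is a unit and there is no condition. -/
theorem exists_polyFun_interpolation [CompleteSpace V] {d : Polynomial ℂ} (hd : d ≠ 0)
    (t : ℂ → ℂ → V) (ht : ∀ x, t x ∈ HolAt V x) :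
    ∃ g ∈ polyFun V, ∀ x, t x - g ∈ germMultiples d x := by
  choose g hg hgx hgy using fun x => exists_polyFun_sub_mem_germMultiples hd (ht x)
  refine ⟨∑ y ∈ d.roots.toFinset, g y, sum_mem fun y _ => hg y, fun x => ?_⟩
  by_cases hx : x ∈ d.roots.toFinset
  · rw [← Finset.add_sum_erase _ _ hx, ← sub_sub]
    exact sub_mem (hgx x) (sum_mem fun y hy => hgy y x (Finset.ne_of_mem_erase hy).symm)
  · refine mem_germMultiples_of_eval_ne_zero ?_
      (sub_mem (ht x) (sum_mem fun y _ => polyFun_le_holAt x (hg y)))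
    simpa [hd] using hx

end PolynomialFunctions

/-! ### Comparison of `l²` with the global sections of the cokernel sheaf -/

section GlobalSections

variable {V : Type*} [NormedAddCommGroup V] [NormedSpace ℂ V] {l r : ℕ}

theorem toH0_congr (p : PolyV V l) {h h' : HolDisk V} (e : Set.EqOn h.1 h'.1 disk) :
    toH0 p h = toH0 p h' := by
  apply Subtype.ext
  funext x
  refine (Submodule.Quotient.eq _).mpr ⟨0, zero_mem _, ?_⟩
  filter_upwards [Metric.isOpen_ball.mem_nhds x.2] with z hz
  change h.1 z - h'.1 z = _
  rw [e hz]
  simp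

variable [FiniteDimensional ℂ V]

theorem PolyV.detPoly_ne_zero (p : PolyS1 V l r) : p.1.detPoly ≠ 0 := fun h => by
  have h1 := (p.2.1 1 (by simp)).map (ContinuousLinearMap.toLinearMapRingHom (R₁ := ℂ) (M₁ := V))
  rw [LinearMap.isUnit_iff_isUnit_det] at h1
  refine h1.ne_zero ?_
  change LinearMap.det (p.1.eval 1 : V →ₗ[ℂ] V) = 0
  rw [← PolyV.eval_detPoly, h, Polynomial.eval_zero]

/-- With `P'` the adjugate symbol, `det p • k = p (P' k)`. -/
theorem germMultiples_detPoly_le (p : PolyV V l) {x : ℂ} {t : ℂ → V} (ht : t ∈ HolAt V x)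
    (h : t ∈ germMultiples p.detPoly x) : (⟨t, ht⟩ : HolAt V x) ∈ stalkImage p x := by
  obtain ⟨P', hP'⟩ := exists_evalHom_mul_eq_det p.symbol
  obtain ⟨k, hk, e⟩ := h
  refine ⟨fun z => evalHom V z P' (k z), ?_, ?_⟩
  · filter_upwards [hk] with z hz
    exact (differentiable_evalHom P').differentiableAt.clm_apply hz
  · filter_upwards [e] with z hz
    rw [hz, ← evalHom_symbol, hP', PolyV.eval_detPoly, evalHom_symbol]

/-- The map from square-summable sequences to global sections of the cokernel sheaf. -/
def hardyToH0 (p : PolyV V l) : L2 V →ₗ[ℂ] H0 p where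
  toFun s := toH0 p (hardy s)
  map_add' s t := by
    rw [← map_add]
    exact toH0_congr p fun z hz => map_add (hardyAt (mem_ball_zero_iff.mp hz)) s t
  map_smul' c s := by
    rw [RingHom.id_apply, ← map_smul]
    exact toH0_congr p fun z hz => map_smul (hardyAt (mem_ball_zero_iff.mp hz)) c s

theorem hardyToH0_shift (p : PolyV V l) (s : L2 V) :
    hardyToH0 p (shift s) = mulZ p (hardyToH0 p s) :=
  toH0_congr (h' := ⟨fun z => z • (hardy s).1 z,
    differentiableOn_id.smul (hardy_differentiableOn s)⟩) p
    fun _ hz => hardyAt_shift (mem_ball_zero_iff.mp hz) s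

theorem hardyToH0_shift_pow (p : PolyV V l) (n : ℕ) (s : L2 V) :
    hardyToH0 p ((shift ^ n) s) = (mulZ p ^ n) (hardyToH0 p s) := by
  induction n with
  | zero => simp
  | succ n ih =>
    rw [pow_succ', pow_succ', Module.End.mul_apply, ← ih, ← hardyToH0_shift]
    rfl

theorem hardyToH0_single_zero (p : PolyV V l) (v : V) :
    hardyToH0 p (lp.single 2 0 v) = toH0 p (constHol V v) :=
  toH0_congr p fun _ hz => hardyAt_single_zero (mem_ball_zero_iff.mp hz) v

variable (V) in
/-- The span of the sequences `S^n (v, 0, 0, …)`. -/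
def polySeq : Submodule ℂ (L2 V) :=
  Submodule.span ℂ (Set.range fun x : ℕ × V => (shift ^ x.1) (lp.single 2 0 x.2))

theorem hardyAt_shift_pow {z : ℂ} (hz : ‖z‖ < 1) (n : ℕ) (s : L2 V) :
    hardyAt hz ((shift ^ n) s) = z ^ n • hardyAt hz s := by
  induction n with
  | zero => simp
  | succ n ih =>
    rw [pow_succ', pow_succ', mul_smul, ← ih]
    exact hardyAt_shift hz _

theorem exists_polySeq {g : ℂ → V} (hg : g ∈ polyFun V) :
    ∃ s ∈ polySeq V, ∀ z (hz : ‖z‖ < 1), hardyAt hz s = g z := by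
  induction hg using Submodule.span_induction with
  | mem g hg =>
    obtain ⟨⟨n, v⟩, rfl⟩ := hg
    exact ⟨_, Submodule.subset_span ⟨(n, v), rfl⟩, fun z hz => by
      rw [hardyAt_shift_pow, hardyAt_single_zero]⟩
  | zero => exact ⟨0, zero_mem _, fun z hz => map_zero _⟩
  | add g g' _ _ h h' =>
    obtain ⟨s, hs, e⟩ := h
    obtain ⟨s', hs', e'⟩ := h'
    exact ⟨s + s', add_mem hs hs', fun z hz => by rw [map_add, e, e']; rfl⟩
  | smul c g _ h =>
    obtain ⟨s, hs, e⟩ := h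
    exact ⟨c • s, Submodule.smul_mem _ c hs, fun z hz => by rw [map_smul, e]; rfl⟩

/-- Representatives of the germs of `σ` are interpolated by one polynomial function modulo `det p`,
and germs divisible by `det p` vanish in the cokernel. -/
theorem exists_polySeq_hardyToH0 (p : PolyS1 V l r) (σ : H0 p.1) :
    ∃ s ∈ polySeq V, hardyToH0 p.1 s = σ := by
  have : CompleteSpace V := FiniteDimensional.complete ℂ V
  have hex : ∀ x : ℂ, ∃ t : HolAt V x, ∀ hx : x ∈ disk,
      σ.1 ⟨x, hx⟩ = Submodule.Quotient.mk t := fun x => by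
    by_cases hx : x ∈ disk
    · obtain ⟨t, ht⟩ := Submodule.Quotient.mk_surjective _ (σ.1 ⟨x, hx⟩)
      exact ⟨t, fun _ => ht.symm⟩
    -- The interpolation takes germs at all points of `ℂ`; those outside the disk are arbitrary.
    · exact ⟨0, fun h => absurd h hx⟩
  choose t ht using hex
  obtain ⟨g, hg, hgt⟩ := exists_polyFun_interpolation (PolyV.detPoly_ne_zero p)
    (fun x => (t x).1) fun x => (t x).2
  obtain ⟨s, hs, hsg⟩ := exists_polySeq hg
  refine ⟨s, hs, ?_⟩
  have h1 : hardyToH0 p.1 s = toH0 p.1 ⟨g, polyFun_le_holDisk hg⟩ :=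
    toH0_congr p.1 fun z hz => hsg z (mem_ball_zero_iff.mp hz)
  rw [h1]
  apply Subtype.ext
  funext x
  rw [show σ.1 x = Submodule.Quotient.mk (t x) from ht x x.2]
  exact ((Submodule.Quotient.eq _).mpr (germMultiples_detPoly_le p.1
    (sub_mem (t x).2 (polyFun_le_holAt x hg)) (hgt x))).symm

theorem fredholm_polyS1 (p : PolyS1 V l r) :
    Function.Injective (toeplitz p.1) ∧
    (∃ β : L2 V →ₗ[ℂ] (Fin r → ℂ), Function.Surjective β ∧
      LinearMap.ker β = (toeplitz p.1).range) ∧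
    ∀ (s : L2 V) (k : ℂ → V), ContinuousOn k disk →
      (∀ z (hz : ‖z‖ < 1), hardyAt hz s = p.1.eval z (k z)) → ∃ t, toeplitz p.1 t = s := by
  have := toepHom_fredholm r p.1.symbol p.1.detPoly
    (fun z => by rw [evalHom_symbol, PolyV.eval_detPoly]) (fun z hz => by
      have h1 := (p.2.1 z hz).map (ContinuousLinearMap.toLinearMapRingHom (R₁ := ℂ) (M₁ := V))
      rw [LinearMap.isUnit_iff_isUnit_det] at h1
      rw [PolyV.eval_detPoly]
      exact h1.ne_zero) p.2.2
  simpa only [toepHom_symbol, evalHom_symbol] using this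

/-- A sequence in the kernel is locally `p` times a holomorphic function. These local quotients
combine to a continuous quotient on the disk, which the range criterion of `fredholm_polyS1`
accepts. -/
theorem ker_hardyToH0 (p : PolyS1 V l r) :
    LinearMap.ker (hardyToH0 p.1) = (toeplitz p.1).range := by
  apply le_antisymm
  · intro s hs
    have hs' : ∀ x ∈ disk, ∃ k ∈ HolAt V x, ∀ᶠ z in 𝓝 x, (hardy s).1 z = p.1.eval z (k z) :=
      fun x hx => (Submodule.Quotient.mk_eq_zero _).mp
        (congrFun (congrArg Subtype.val (show toH0 p.1 (hardy s) = 0 from hs)) ⟨x, hx⟩)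
    choose! k hk hke using hs'
    -- The quotient at `z` is the value at `z` of the local quotient chosen there. Near `x`, `p` is
    -- invertible at every `z ≠ x`, so `k z z = k x z`, and continuity at `x` follows from that of
    -- `k x`.
    refine (fredholm_polyS1 p).2.2 s (fun z => k z z) (fun x hx => ?_) fun z hz =>
      (hke z (mem_ball_zero_iff.mpr hz)).self_of_nhds
    have hfin : ∀ᶠ z in 𝓝 x, z ∉ p.1.detPoly.roots.toFinset.erase x :=
      ((Finset.finite_toSet _).isClosed.isOpen_compl.mem_nhds (by simp))
    have hkx : ContinuousAt (k x) x := (hk x hx).self_of_nhds.continuousAt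
    refine (hkx.congr ?_).continuousWithinAt
    filter_upwards [hfin, hke x hx, Metric.isOpen_ball.mem_nhds hx] with z h1 h2 h3
    by_cases hzx : z = x
    · rw [hzx]
    have h4 := (hke z h3).self_of_nhds
    rw [h2] at h4
    have h5 : IsUnit (p.1.eval z : V →ₗ[ℂ] V) := by
      rw [LinearMap.isUnit_iff_isUnit_det, ← PolyV.eval_detPoly, isUnit_iff_ne_zero]
      intro h0
      exact h1 (Finset.mem_erase.mpr ⟨hzx, Multiset.mem_toFinset.mpr
        ((Polynomial.mem_roots (PolyV.detPoly_ne_zero p)).mpr h0)⟩)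
    exact ((Module.End.isUnit_iff _).mp h5).1 h4
  · rintro _ ⟨t, rfl⟩
    apply Subtype.ext
    funext x
    refine (Submodule.Quotient.mk_eq_zero _).mpr ⟨(hardy t).1, HolDisk.holAt (hardy t).2 x, ?_⟩
    filter_upwards [Metric.isOpen_ball.mem_nhds x.2] with z hz
    have := hardyAt_toepHom (mem_ball_zero_iff.mp hz) p.1.symbol t
    rwa [toepHom_symbol, evalHom_symbol] at this

/-- A linear surjection `l² → ℂ^r` with the range of the Toeplitz operator as its kernel identifies
`H⁰` with `ℂ^r`. -/
theorem exists_equiv_H0 (p : PolyS1 V l r) {β : L2 V →ₗ[ℂ] (Fin r → ℂ)}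
    (hβ : Function.Surjective β) (hk : LinearMap.ker β = (toeplitz p.1).range) :
    ∃ φ : H0 p.1 ≃ₗ[ℂ] (Fin r → ℂ), ∀ s, φ (hardyToH0 p.1 s) = β s := by
  choose c hc using fun σ => (exists_polySeq_hardyToH0 p σ).imp fun _ h => h.2
  choose b hb using hβ
  have h1 : ∀ s s', hardyToH0 p.1 s = hardyToH0 p.1 s' → β s = β s' := fun s s' h => by
    have h0 : s + (-1 : ℂ) • s' ∈ LinearMap.ker (hardyToH0 p.1) := by
      rw [LinearMap.mem_ker, map_add, h, ← map_add, neg_one_smul, add_neg_cancel, map_zero]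
    rw [ker_hardyToH0, ← hk, LinearMap.mem_ker, map_add, neg_one_smul, map_neg] at h0
    exact eq_of_sub_eq_zero (by rwa [sub_eq_add_neg])
  have h2 : ∀ s s', β s = β s' → hardyToH0 p.1 s = hardyToH0 p.1 s' := fun s s' h => by
    have h0 : s - s' ∈ LinearMap.ker β := by rw [LinearMap.mem_ker, map_sub, h, sub_self]
    rw [hk, ← ker_hardyToH0, LinearMap.mem_ker] at h0
    rw [← sub_add_cancel s s', map_add, h0, zero_add]
  refine ⟨
    { toFun := fun σ => β (c σ)
      invFun := fun y => hardyToH0 p.1 (b y)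
      map_add' := fun σ τ => by
        rw [← map_add]
        exact h1 _ _ (by rw [map_add, hc, hc, hc])
      map_smul' := fun t σ => by
        rw [RingHom.id_apply, ← map_smul]
        exact h1 _ _ (by rw [map_smul, hc, hc])
      left_inv := fun σ => (h2 _ _ (hb _)).trans (hc σ)
      right_inv := fun y => (h1 _ _ (hc _)).trans (hb y) }, fun s => h1 _ _ (hc _)⟩

theorem exists_equiv_H0_pi (p : PolyS1 V l r) : Nonempty (H0 p.1 ≃ₗ[ℂ] (Fin r → ℂ)) := by
  obtain ⟨β, hβ, hk⟩ := (fredholm_polyS1 p).2.1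
  exact ⟨(exists_equiv_H0 p hβ hk).choose⟩

omit [FiniteDimensional ℂ V] in
theorem shift_single (n : ℕ) (v : V) : shift (lp.single 2 n v) = lp.single 2 (n + 1) v := by
  ext k
  cases k with
  | zero => simp [shift_zero, lp.single_apply]
  | succ k => simp [shift_succ, lp.single_apply, Pi.single_apply]

omit [FiniteDimensional ℂ V] in
theorem shift_pow_single_zero (n : ℕ) (v : V) :
    (shift ^ n) (lp.single 2 0 v) = lp.single 2 n v := by
  induction n with
  | zero => simp
  | succ n ih =>
    rw [pow_succ', ← shift_single, ← ih]
    rfl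

theorem hardyToH0_inclL2 (p : PolyV V l) (v : Fin r → V) :
    hardyToH0 p (inclL2 v) = ∑ i : Fin r, (mulZ p ^ (i : ℕ)) (toH0 p (constHol V (v i))) := by
  rw [inclL2, map_sum]
  refine Finset.sum_congr rfl fun i _ => ?_
  rw [← shift_pow_single_zero, hardyToH0_shift_pow, hardyToH0_single_zero]

/-- `H⁰` is generated by `z^i V` for `i < r`. -/
theorem exists_hardyToH0_inclL2_eq (p : PolyS1 V l r) (σ : H0 p.1) :
    ∃ v : Fin r → V, hardyToH0 p.1 (inclL2 v) = σ := by
  obtain ⟨φ⟩ := exists_equiv_H0_pi p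
  -- For `r = 0` the characteristic polynomial is `1` and the degree bound on remainders below
  -- fails.
  rcases Nat.eq_zero_or_pos r with rfl | hr
  · exact ⟨0, φ.injective (Subsingleton.elim _ _)⟩
  let A : Module.End ℂ (Fin r → ℂ) := φ.toLinearMap ∘ₗ mulZ p.1 ∘ₗ φ.symm.toLinearMap
  have hA : ∀ n τ, φ ((mulZ p.1 ^ n) τ) = (A ^ n) (φ τ) := fun n τ => by
    induction n with
    | zero => rfl
    | succ n ih =>
      rw [pow_succ', pow_succ', Module.End.mul_apply, Module.End.mul_apply, ← ih]
      simp [A]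
  let ι : V →ₗ[ℂ] (Fin r → ℂ) := φ.toLinearMap ∘ₗ toH0 p.1 ∘ₗ constHol V
  let q : (Fin r → V) →ₗ[ℂ] (Fin r → ℂ) :=
    ∑ i : Fin r, (A ^ (i : ℕ)) ∘ₗ ι ∘ₗ LinearMap.proj i
  have hq : ∀ v, q v = φ (hardyToH0 p.1 (inclL2 v)) := fun v => by
    rw [hardyToH0_inclL2, map_sum, LinearMap.sum_apply]
    exact Finset.sum_congr rfl fun i _ => (hA _ _).symm
  suffices h : polySeq V ≤ (LinearMap.range q).comap (φ.toLinearMap ∘ₗ hardyToH0 p.1) by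
    obtain ⟨s, hs, rfl⟩ := exists_polySeq_hardyToH0 p σ
    obtain ⟨v, hv⟩ := h hs
    exact ⟨v, φ.injective ((hq v).symm.trans hv)⟩
  refine Submodule.span_le.mpr ?_
  rintro _ ⟨⟨n, v⟩, rfl⟩
  -- Cayley-Hamilton: `A ^ n` equals a polynomial in `A` of degree less than `r`, whose coefficients
  -- times `v` give the required tuple.
  set P := Polynomial.X ^ n %ₘ A.charpoly with hP
  have hdeg : P.natDegree < r := by
    have h1 : A.charpoly.natDegree = r := by rw [LinearMap.charpoly_natDegree]; simp
    rw [← h1]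
    refine Polynomial.natDegree_modByMonic_lt _ (LinearMap.charpoly_monic _) fun h => ?_
    rw [h, Polynomial.natDegree_one] at h1
    omega
  refine ⟨fun i => P.coeff i • v, ?_⟩
  change _ = φ (hardyToH0 p.1 ((shift ^ n) (lp.single 2 0 v)))
  rw [hardyToH0_shift_pow, hardyToH0_single_zero, hA, LinearMap.pow_eq_aeval_mod_charpoly, ← hP,
    Polynomial.aeval_eq_sum_range' hdeg, LinearMap.sum_apply, Finset.sum_range,
    LinearMap.sum_apply]
  refine Finset.sum_congr rfl fun i _ => ?_
  simp [ι]

end GlobalSections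

/-! ### Well-definedness of the configuration map -/

section Presentations

variable {V : Type*} [NormedAddCommGroup V] [NormedSpace ℂ V] {l r : ℕ}

/-- For `c` outside the disk, `z - c` is invertible on every stalk. This confines the eigenvalues of
`A` to `D`. -/
theorem eq_zero_of_mulZ_eq_smul (p : PolyV V l) {c : ℂ} (hc : c ∉ disk) {σ : H0 p}
    (h : mulZ p σ = c • σ) : σ = 0 := by
  apply Subtype.ext
  funext x
  obtain ⟨t, ht⟩ := Submodule.Quotient.mk_surjective _ (σ.1 x)
  have h1 : mulZStalk p x (σ.1 x) = c • σ.1 x := congrFun (congrArg Subtype.val h) x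
  rw [← ht] at h1
  obtain ⟨k, hk, e⟩ := (Submodule.Quotient.eq (stalkImage p (x : ℂ))
    (x := mulZHol (x : ℂ) t) (y := c • t)).mp h1
  have hx : (Polynomial.X - Polynomial.C c).eval (x : ℂ) ≠ 0 := by
    simp only [Polynomial.eval_sub, Polynomial.eval_X, Polynomial.eval_C, sub_ne_zero]
    exact fun hxc => hc (hxc ▸ x.2)
  rw [← ht]
  refine (Submodule.Quotient.mk_eq_zero _).mpr ⟨_, inv_eval_smul_mem_holAt hx hk, ?_⟩
  filter_upwards [e, (Polynomial.X - Polynomial.C c).continuous.continuousAt.eventually_ne hx]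
    with z hz hzx
  rw [map_smul, ← hz]
  change t.1 z = _ • (z • t.1 z - c • t.1 z)
  rw [← sub_smul, eq_inv_smul_iff₀ hzx]
  simp

variable [FiniteDimensional ℂ V]

theorem exists_presents (p : PolyS1 V l r) (φ : H0 p.1 ≃ₗ[ℂ] (Fin r → ℂ)) :
    ∃ a : ConfTilde V disk r, Presents p.1 φ a := by
  set A : Matrix (Fin r) (Fin r) ℂ :=
    LinearMap.toMatrix' (φ.toLinearMap ∘ₗ mulZ p.1 ∘ₗ φ.symm.toLinearMap) with hA
  have hAφ : ∀ σ, A.mulVec (φ σ) = φ (mulZ p.1 σ) := fun σ => by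
    rw [hA, LinearMap.toMatrix'_mulVec]
    simp
  have hAn : ∀ (n : ℕ) σ, (A ^ n).mulVec (φ σ) = φ ((mulZ p.1 ^ n) σ) := fun n σ => by
    induction n with
    | zero => simp
    | succ n ih =>
      rw [pow_succ', pow_succ', Module.End.mul_apply, ← hAφ, ← ih, Matrix.mulVec_mulVec]
  let ι : V →L[ℂ] (Fin r → ℂ) :=
    LinearMap.toContinuousLinearMap (φ.toLinearMap ∘ₗ toH0 p.1 ∘ₗ constHol V)
  have hι : ∀ v, ι v = φ (toH0 p.1 (constHol V v)) := fun v => rfl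
  refine ⟨⟨(A, ι), ?_, ?_⟩, fun s => (hAφ s).symm, hι⟩
  · intro c hc
    by_contra hcd
    rw [← Matrix.spectrum_toLin', ← Module.End.hasEigenvalue_iff_mem_spectrum] at hc
    obtain ⟨y, hy⟩ := hc.exists_hasEigenvector
    have h1 : A.mulVec y = c • y := hy.apply_eq_smul
    refine hy.2 ?_
    rw [← φ.apply_symm_apply y, eq_zero_of_mulZ_eq_smul p.1 hcd (σ := φ.symm y), map_zero]
    apply φ.injective
    rw [← hAφ, map_smul, φ.apply_symm_apply, h1]
  · intro y
    obtain ⟨v, hv⟩ := exists_hardyToH0_inclL2_eq p (φ.symm y)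
    refine ⟨v, ?_⟩
    rw [← φ.apply_symm_apply y, ← hv, hardyToH0_inclL2, map_sum]
    exact Finset.sum_congr rfl fun i _ => by rw [← hAn]; rfl

omit [FiniteDimensional ℂ V] in
-- The group element is the change of coordinates `φ' ∘ φ⁻¹`.
theorem Presents.exists_movesTo {p : PolyV V l} {φ φ' : H0 p ≃ₗ[ℂ] (Fin r → ℂ)}
    {a a' : ConfTilde V disk r} (h : Presents p φ a) (h' : Presents p φ' a') :
    ∃ g : GL (Fin r) ℂ, MovesTo g a a' ∧
      ∀ σ, φ' σ = (g : Matrix (Fin r) (Fin r) ℂ).mulVec (φ σ) := by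
  let g : GL (Fin r) ℂ :=
    { val := LinearMap.toMatrix' (φ'.toLinearMap ∘ₗ φ.symm.toLinearMap)
      inv := LinearMap.toMatrix' (φ.toLinearMap ∘ₗ φ'.symm.toLinearMap)
      val_inv := by
        rw [← LinearMap.toMatrix'_comp, ← LinearMap.toMatrix'_id]
        congr 1
        ext : 2
        simp
      inv_val := by
        rw [← LinearMap.toMatrix'_comp, ← LinearMap.toMatrix'_id]
        congr 1
        ext : 2
        simp }
  have hg : ∀ σ, φ' σ = (g : Matrix (Fin r) (Fin r) ℂ).mulVec (φ σ) := fun σ => by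
    change _ = (LinearMap.toMatrix' (φ'.toLinearMap ∘ₗ φ.symm.toLinearMap)).mulVec (φ σ)
    rw [LinearMap.toMatrix'_mulVec]
    simp
  refine ⟨g, ⟨?_, fun v => by rw [h'.2, h.2, hg]⟩, hg⟩
  have : a'.1.1 * g = g * a.1.1 := by
    apply Matrix.ext_of_mulVec_single
    intro j
    obtain ⟨σ, hσ⟩ := φ.surjective (Pi.single j 1)
    rw [← hσ, ← Matrix.mulVec_mulVec, ← Matrix.mulVec_mulVec, ← hg, ← h'.1, ← h.1, ← hg]
  rw [← this, mul_assoc, Units.mul_inv, mul_one]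

omit [FiniteDimensional ℂ V] in
theorem isConfOf_unique {p : PolyV V l} {c c' : Conf V disk r} (h : IsConfOf p c)
    (h' : IsConfOf p c') : c = c' := by
  obtain ⟨φ, a, hp, rfl⟩ := h
  obtain ⟨φ', a', hp', rfl⟩ := h'
  obtain ⟨g, hg, -⟩ := hp.exists_movesTo hp'
  exact Quotient.sound ⟨g, hg⟩

/-- `confDisk` is a choice among the presented classes; the existence of one presentation makes that
choice meaningful. -/
theorem isConfOf_confDisk (p : PolyS1 V l r) : IsConfOf p.1 (confDisk p) := by
  have := Conf.nonempty_of_polyS1 p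
  obtain ⟨φ⟩ := exists_equiv_H0_pi p
  obtain ⟨a, ha⟩ := exists_presents p φ
  exact Classical.epsilon_spec (p := IsConfOf p.1) ⟨Conf.mk a, φ, a, ha, rfl⟩

theorem isConfOf_iff (p : PolyS1 V l r) (c : Conf V disk r) : IsConfOf p.1 c ↔ c = confDisk p :=
  ⟨fun h => isConfOf_unique h (isConfOf_confDisk p), fun h => h ▸ isConfOf_confDisk p⟩

theorem Presents.mk_eq_confDisk {p : PolyS1 V l r} {φ : H0 p.1 ≃ₗ[ℂ] (Fin r → ℂ)}
    {a : ConfTilde V disk r} (h : Presents p.1 φ a) : Conf.mk a = confDisk p :=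
  (isConfOf_iff p _).mp ⟨φ, a, h, rfl⟩

end Presentations

/-! ### Continuity of the configuration map -/

section LocalLifts

variable {V : Type*} [NormedAddCommGroup V] [NormedSpace ℂ V] {l r : ℕ}

variable (V r) in
/-- The inclusion `V^r → l²` as a continuous linear map. -/
def inclCLM : (Fin r → V) →L[ℂ] L2 V :=
  ∑ i : Fin r, lp.singleContinuousLinearMap ℂ (fun _ : ℕ => V) 2 (i : ℕ) ∘L
    ContinuousLinearMap.proj i

theorem inclCLM_apply (v : Fin r → V) : inclCLM V r v = inclL2 v := by
  simp [inclCLM, inclL2]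

variable [FiniteDimensional ℂ V]

theorem continuous_toeplitz : Continuous fun p : PolyV V l => toeplitz p := by
  let c : (V →L[ℂ] V) →ₗ[ℂ] (L2 V →L[ℂ] L2 V) :=
    { toFun := coeffHom V
      map_add' := map_add _
      map_smul' := coeffHom_smul }
  have hc : Continuous c := c.continuous_of_finiteDimensional
  exact continuous_finsetSum _ fun j _ =>
    (hc.comp (continuous_apply j)).clm_comp continuous_const

/-- Near every polynomial the cokernel of the Toeplitz operator is identified with `ℂ^r`
by a continuous family of projections with a constant section. -/
theorem exists_local_projection (p₀ : PolyS1 V l r) :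
    ∃ (k : (Fin r → ℂ) →L[ℂ] (Fin r → V)) (U : Set (PolyS1 V l r))
      (β : PolyS1 V l r → L2 V →L[ℂ] (Fin r → ℂ)), IsOpen U ∧ p₀ ∈ U ∧ ContinuousOn β U ∧
      ∀ p ∈ U, (∀ y, β p (inclL2 (k y)) = y) ∧
        LinearMap.ker (β p : L2 V →ₗ[ℂ] (Fin r → ℂ)) = (toeplitz p.1).range := by
  have : CompleteSpace V := FiniteDimensional.complete ℂ V
  obtain ⟨hinj, ⟨β₀, hβ₀, hk₀⟩, -⟩ := fredholm_polyS1 p₀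
  obtain ⟨φ, hφ⟩ := exists_equiv_H0 p₀ hβ₀ hk₀
  have hs : Function.Surjective (β₀ ∘ₗ (inclCLM V r : (Fin r → V) →ₗ[ℂ] L2 V)) := fun y => by
    obtain ⟨v, hv⟩ := exists_hardyToH0_inclL2_eq p₀ (φ.symm y)
    refine ⟨v, ?_⟩
    change β₀ (inclCLM V r v) = y
    rw [inclCLM_apply, ← hφ, hv, φ.apply_symm_apply]
  obtain ⟨k₀, hk⟩ := LinearMap.exists_rightInverse_of_surjective _
    (LinearMap.range_eq_top.mpr hs)
  let k : (Fin r → ℂ) →L[ℂ] (Fin r → V) := LinearMap.toContinuousLinearMap k₀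
  have hk' : ∀ y, β₀ (inclCLM V r (k y)) = y := fun y => LinearMap.congr_fun hk y
  let J : (Fin r → ℂ) →L[ℂ] L2 V := inclCLM V r ∘L k
  -- The bordered operator `(s, y) ↦ T_p s + J y`. At `p₀` it is bijective because `J` maps onto a
  -- complement of the range. Wherever it is invertible, the second component of its inverse is a
  -- projection with kernel the range of `T_p`, and it sends `J y` to `y`.
  let M : PolyS1 V l r → (L2 V × (Fin r → ℂ)) →L[ℂ] L2 V := fun p =>
    toeplitz p.1 ∘L ContinuousLinearMap.fst ℂ _ _ + J ∘L ContinuousLinearMap.snd ℂ _ _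
  have hMa : ∀ p s y, M p (s, y) = toeplitz p.1 s + J y := fun p s y => rfl
  have hM : Continuous M :=
    ((continuous_toeplitz.comp continuous_subtype_val).clm_comp continuous_const).add
      continuous_const
  have hTβ : ∀ s, β₀ (toeplitz p₀.1 s) = 0 := fun s => by
    rw [← LinearMap.mem_ker, hk₀]
    exact ⟨s, rfl⟩
  have hb : Function.Bijective (M p₀) := by
    constructor
    · rw [injective_iff_map_eq_zero]
      rintro ⟨s, y⟩ h
      rw [hMa] at h
      have hy : y = 0 := by
        have := congrArg β₀ h
        rwa [map_add, hTβ, zero_add, map_zero, show β₀ (J y) = y from hk' y] at this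
      rw [hy, map_zero, add_zero] at h
      rw [hy, hinj (h.trans (map_zero _).symm)]
      rfl
    · intro s
      have h1 : s - J (β₀ s) ∈ LinearMap.ker β₀ := by
        rw [LinearMap.mem_ker, map_sub, show β₀ (J (β₀ s)) = β₀ s from hk' _, sub_self]
      rw [hk₀] at h1
      obtain ⟨t, ht⟩ := h1
      refine ⟨(t, β₀ s), ?_⟩
      rw [hMa, show toeplitz p₀.1 t = s - J (β₀ s) from ht, sub_add_cancel]
  let e₀ := ContinuousLinearEquiv.ofBijective (M p₀) (LinearMap.ker_eq_bot.mpr hb.1)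
    (LinearMap.range_eq_top.mpr hb.2)
  refine ⟨k, M ⁻¹' Set.range ((↑) : ((L2 V × (Fin r → ℂ)) ≃L[ℂ] L2 V) → _),
    fun p => ContinuousLinearMap.snd ℂ _ _ ∘L (M p).inverse,
    (ContinuousLinearEquiv.isOpen).preimage hM, ⟨e₀, by ext <;> rfl⟩, ?_, ?_⟩
  · rintro p ⟨e, he⟩
    refine ContinuousAt.continuousWithinAt ?_
    have h1 : ContinuousAt ContinuousLinearMap.inverse (M p) := by
      rw [← he]
      exact (contDiffAt_map_inverse (𝕜 := ℂ) (n := 1) e).continuousAt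
    exact continuousAt_const.clm_comp (ContinuousAt.comp (f := M) h1 hM.continuousAt)
  · rintro p ⟨e, he⟩
    have hea : ∀ s y, e (s, y) = toeplitz p.1 s + J y := fun s y => by
      rw [← hMa, ← he]
      rfl
    have hβ : ∀ s, (ContinuousLinearMap.snd ℂ _ _ ∘L (M p).inverse) s = (e.symm s).2 := fun s => by
      rw [← he, ContinuousLinearMap.inverse_equiv]
      rfl
    refine ⟨fun y => ?_, ?_⟩
    · rw [hβ, ← inclCLM_apply, show e.symm (inclCLM V r (k y)) = (0, y) by
        rw [ContinuousLinearEquiv.symm_apply_eq, hea, map_zero, zero_add]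
        rfl]
    · ext s
      rw [LinearMap.mem_ker, ContinuousLinearMap.coe_coe, hβ]
      constructor
      · intro h
        refine ⟨(e.symm s).1, ?_⟩
        conv_rhs => rw [← e.apply_symm_apply s, ← Prod.mk.eta (p := e.symm s), h, hea, map_zero,
          add_zero]
        rfl
      · rintro ⟨t, rfl⟩
        have h1 : e.symm (toeplitz p.1 t) = (t, 0) := by
          rw [ContinuousLinearEquiv.symm_apply_eq, hea, map_zero, add_zero]
        exact congrArg Prod.snd h1

/-- Under the identification induced by `β`, multiplication by `z` is the shift followed by `β`, and
`ι` is `β` on sequences `(v, 0, 0, …)`. Both formulas are continuous in `β`. -/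
theorem exists_presents_of_projection (p : PolyS1 V l r) {β : L2 V →L[ℂ] (Fin r → ℂ)}
    {k : (Fin r → ℂ) → (Fin r → V)} (hk : ∀ y, β (inclL2 (k y)) = y)
    (hker : LinearMap.ker (β : L2 V →ₗ[ℂ] (Fin r → ℂ)) = (toeplitz p.1).range) :
    ∃ (φ : H0 p.1 ≃ₗ[ℂ] (Fin r → ℂ)) (a : ConfTilde V disk r), Presents p.1 φ a ∧
      (∀ s, φ (hardyToH0 p.1 s) = β s) ∧
      a.1.1 = Matrix.of (fun i j => β (shift (inclL2 (k (Pi.single j 1)))) i) ∧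
      a.1.2 = β ∘L lp.singleContinuousLinearMap ℂ (fun _ : ℕ => V) 2 0 := by
  obtain ⟨φ, hφ⟩ := exists_equiv_H0 p (β := (β : L2 V →ₗ[ℂ] (Fin r → ℂ))) (fun y => ⟨_, hk y⟩) hker
  obtain ⟨a, ha⟩ := exists_presents p φ
  refine ⟨φ, a, ha, hφ, ?_, ?_⟩
  · apply Matrix.ext_of_mulVec_single
    intro j
    have h1 : Pi.single j 1 = φ (hardyToH0 p.1 (inclL2 (k (Pi.single j 1)))) :=
      ((hφ _).trans (hk _)).symm
    conv_lhs => rw [h1, ← ha.1, ← hardyToH0_shift, hφ]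
    ext i
    simp [Matrix.mulVec_single]
  · ext v : 1
    rw [ha.2, ← hardyToH0_single_zero, hφ]
    rfl

/-- Local continuous lifts of the configuration map. -/
theorem exists_local_lift (p₀ : PolyS1 V l r) :
    ∃ (k : (Fin r → ℂ) →L[ℂ] (Fin r → V)) (U : Set (PolyS1 V l r))
      (β : U → L2 V →L[ℂ] (Fin r → ℂ)) (φ : ∀ p : U, H0 p.1.1 ≃ₗ[ℂ] (Fin r → ℂ))
      (a : U → ConfTilde V disk r), IsOpen U ∧ p₀ ∈ U ∧ Continuous β ∧ Continuous a ∧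
      ∀ p : U, Presents p.1.1 (φ p) (a p) ∧ (∀ s, φ p (hardyToH0 p.1.1 s) = β p s) ∧
        (∀ y, β p (inclL2 (k y)) = y) := by
  obtain ⟨k, U, β, hU, h0, hβ, h⟩ := exists_local_projection p₀
  choose φ a hp hφ hA hι using fun p : U =>
    exists_presents_of_projection p.1 (h p.1 p.2).1 (h p.1 p.2).2
  have hβ' : Continuous fun p : U => β p.1 := continuousOn_iff_continuous_domRestrict.mp hβ
  refine ⟨k, U, fun p => β p.1, φ, a, hU, h0, hβ', ?_, fun p => ⟨hp p, hφ p, (h p.1 p.2).1⟩⟩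
  refine continuous_induced_rng.mpr (Continuous.prodMk ?_ ?_)
  · simp only [hA]
    refine continuous_pi fun i => continuous_pi fun j => ?_
    exact (continuous_apply i).comp (hβ'.clm_apply continuous_const)
  · simp only [hι]
    exact hβ'.clm_comp continuous_const

theorem continuous_confDisk : Continuous (confDisk : PolyS1 V l r → Conf V disk r) := by
  rw [continuous_iff_continuousAt]
  intro p₀
  obtain ⟨k, U, β, φ, a, hU, h0, -, ha, h⟩ := exists_local_lift p₀
  refine ContinuousOn.continuousAt ?_ (hU.mem_nhds h0)
  rw [continuousOn_iff_continuous_domRestrict]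
  have : U.domRestrict (confDisk : PolyS1 V l r → Conf V disk r) = fun p => Conf.mk (a p) := by
    ext1 p
    exact ((h p).1.mk_eq_confDisk).symm
  rw [this]
  exact continuous_quotient_mk'.comp ha

end LocalLifts

/-! ### Vector bundles from local frames -/

section LocalFrames

variable {B : Type*} [TopologicalSpace B] {F : Type*} [NormedAddCommGroup F] [NormedSpace ℂ F]
  {E : B → Type*} [∀ x, AddCommMonoid (E x)] [∀ x, Module ℂ (E x)] [∀ x, TopologicalSpace (E x)]
  [TopologicalSpace (TotalSpace F E)]

variable (F E) in
/-- A local trivialization of a family of vector spaces over an open set, together with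
its inverse. -/
structure LocalFrame where
  base : Set B
  isOpen_base : IsOpen base
  coord : ∀ b, E b →ₗ[ℂ] F
  frame : ∀ b, F →ₗ[ℂ] E b
  coord_frame : ∀ b ∈ base, ∀ v, coord b (frame b v) = v
  frame_coord : ∀ b ∈ base, ∀ y, frame b (coord b y) = y
  continuousOn_coord : ContinuousOn (fun z : TotalSpace F E => coord z.1 z.2) (π F E ⁻¹' base)
  continuousOn_frame : ContinuousOn (fun y : B × F => (⟨y.1, frame y.1 y.2⟩ : TotalSpace F E))
    (base ×ˢ Set.univ)
  continuous_coord : ∀ b ∈ base, Continuous (coord b)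
  continuous_frame : ∀ b ∈ base, Continuous (frame b)

/-- The trivialization given by a local frame. -/
def LocalFrame.triv (φ : LocalFrame F E) (hproj : Continuous (π F E)) :
    Trivialization F (π F E) where
  toFun z := (z.1, φ.coord z.1 z.2)
  invFun y := ⟨y.1, φ.frame y.1 y.2⟩
  source := π F E ⁻¹' φ.base
  target := φ.base ×ˢ Set.univ
  map_source' z hz := ⟨hz, Set.mem_univ _⟩
  map_target' y hy := hy.1
  left_inv' := by
    rintro ⟨b, y⟩ hb
    simp only [φ.frame_coord b hb]
  right_inv' := by
    rintro ⟨b, v⟩ hb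
    simp only [φ.coord_frame b hb.1]
  open_source := φ.isOpen_base.preimage hproj
  open_target := φ.isOpen_base.prod isOpen_univ
  continuousOn_toFun := hproj.continuousOn.prodMk φ.continuousOn_coord
  continuousOn_invFun := φ.continuousOn_frame
  baseSet := φ.base
  open_baseSet := φ.isOpen_base
  source_eq := rfl
  target_eq := rfl
  proj_toFun _ _ := rfl

/-- On the fiber over `b` the coordinates and the frame are mutually inverse and continuous for the
topology of the fiber; in the total space they are continuous as well, so the two topologies agree.
-/
theorem LocalFrame.isInducing (φ : LocalFrame F E) (hproj : Continuous (π F E)) {b : B}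
    (hb : b ∈ φ.base) : Topology.IsInducing (@TotalSpace.mk B F E b) := by
  rw [Topology.isInducing_iff_nhds]
  intro y
  apply le_antisymm
  · have h1 : Continuous fun v : F => (⟨b, φ.frame b v⟩ : TotalSpace F E) :=
      φ.continuousOn_frame.comp_continuous (Continuous.prodMk_right b)
        fun v => ⟨hb, Set.mem_univ _⟩
    have h2 : (TotalSpace.mk b : E b → TotalSpace F E) =
        (fun v : F => (⟨b, φ.frame b v⟩ : TotalSpace F E)) ∘ φ.coord b := by
      ext1 z
      simp only [Function.comp_apply, φ.frame_coord b hb]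
    have h3 : Continuous (TotalSpace.mk b : E b → TotalSpace F E) := by
      rw [h2]
      exact h1.comp (φ.continuous_coord b hb)
    exact h3.continuousAt.le_comap
  · have h1 : ContinuousAt (fun z : TotalSpace F E => φ.coord z.1 z.2) ⟨b, y⟩ :=
      φ.continuousOn_coord.continuousAt ((φ.isOpen_base.preimage hproj).mem_nhds hb)
    have h2 := ((φ.continuous_frame b hb).continuousAt (x := φ.coord b y)).tendsto.comp
      (h1.tendsto.comp (Filter.tendsto_comap (f := (TotalSpace.mk b : E b → TotalSpace F E))))
    rw [φ.frame_coord b hb] at h2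
    refine Filter.tendsto_id'.mp (h2.congr fun z => ?_)
    exact φ.frame_coord b hb z

theorem isVectorBundle_of_localFrames [FiniteDimensional ℂ F] (hproj : Continuous (π F E))
    (h : ∀ b, ∃ φ : LocalFrame F E, b ∈ φ.base) : IsVectorBundle F E := by
  choose φ hφ using h
  let fb : FiberBundle F E :=
    { totalSpaceMk_isInducing' := fun b => (φ b).isInducing hproj (hφ b)
      trivializationAtlas' := Set.range fun b => (φ b).triv hproj
      trivializationAt' := fun b => (φ b).triv hproj
      mem_baseSet_trivializationAt' := hφ
      trivialization_mem_atlas' := fun b => ⟨b, rfl⟩ }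
  have hlin : ∀ b, ((φ b).triv hproj).IsLinear ℂ := fun b => ⟨fun c _ => ((φ b).coord c).isLinear⟩
  refine ⟨fb, ⟨?_, ?_⟩⟩
  · rintro _ ⟨b, rfl⟩
    exact hlin b
  · rintro _ _ ⟨b, rfl⟩ ⟨b', rfl⟩
    -- As `F` is finite-dimensional, norm continuity of the coordinate change may be checked on
    -- single vectors.
    rw [continuousOn_clm_apply]
    intro v
    have h1 : ContinuousOn (fun c => (φ b').coord c ((φ b).frame c v))
        ((φ b).base ∩ (φ b').base) :=
      (φ b').continuousOn_coord.comp ((φ b).continuousOn_frame.comp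
        (Continuous.prodMk_left v).continuousOn fun c hc => ⟨hc.1, Set.mem_univ _⟩) fun c hc => hc.2
    refine h1.congr fun c hc => ?_
    exact Trivialization.coordChangeL_apply' _ _ hc v

end LocalFrames

/-! ### Local triviality of the global section bundle -/

section GlobalSectionBundle

variable {V : Type*} [NormedAddCommGroup V] [NormedSpace ℂ V] {U : Set ℂ} {r : ℕ}

/-- The map `∑ A^i ι : V^r → ℂ^r` of a configuration `(A, ι)`. -/
def ConfTilde.piMap (a : ConfTilde V U r) : (Fin r → V) →ₗ[ℂ] (Fin r → ℂ) :=
  ∑ i : Fin r, (a.1.1 ^ (i : ℕ)).mulVecLin ∘ₗ (a.1.2 : V →ₗ[ℂ] (Fin r → ℂ)) ∘ₗ LinearMap.proj i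

theorem ConfTilde.piMap_apply (a : ConfTilde V U r) (v : Fin r → V) :
    ConfTilde.piMap a v = ∑ i : Fin r, (a.1.1 ^ (i : ℕ)).mulVec (a.1.2 (v i)) := by
  simp [ConfTilde.piMap]

theorem ConfTilde.continuous_piMap {X : Type*} [TopologicalSpace X] {a : X → ConfTilde V U r}
    {v : X → Fin r → V} (ha : Continuous a) (hv : Continuous v) :
    Continuous fun x => ConfTilde.piMap (a x) (v x) := by
  simp only [ConfTilde.piMap_apply]
  refine continuous_finsetSum _ fun i _ => Continuous.matrix_mulVec ?_ ?_
  · exact (continuous_subtype_val.comp ha).fst.pow _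
  · exact (continuous_subtype_val.comp ha).snd.clm_apply ((continuous_apply i).comp hv)

theorem MovesTo.piMap {g : GL (Fin r) ℂ} {a b : ConfTilde V U r} (h : MovesTo g a b)
    (v : Fin r → V) :
    ConfTilde.piMap b v = (g : Matrix (Fin r) (Fin r) ℂ).mulVec (ConfTilde.piMap a v) := by
  rw [ConfTilde.piMap_apply, ConfTilde.piMap_apply, Matrix.mulVec_sum]
  refine Finset.sum_congr rfl fun i _ => ?_
  have h1 : b.1.1 * g = g * a.1.1 := by
    rw [h.1]
    simp only [mul_assoc, Units.inv_mul, mul_one]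
  have h2 : b.1.1 ^ (i : ℕ) * g = g * a.1.1 ^ (i : ℕ) :=
    ((show SemiconjBy (g : Matrix (Fin r) (Fin r) ℂ) a.1.1 b.1.1 from h1.symm).pow_right i).eq.symm
  rw [h.2, Matrix.mulVec_mulVec, Matrix.mulVec_mulVec, h2]

theorem EFib.mk_sum {c : Conf V U r} (a : ConfTilde V U r) (ha : Conf.mk a = c) {ι : Type*}
    (s : Finset ι) (v : ι → Fin r → ℂ) :
    EFib.mk a ha (∑ i ∈ s, v i) = ∑ i ∈ s, EFib.mk a ha (v i) :=
  map_sum (AddMonoidHom.mk' (EFib.mk a ha) (EFib.mk_add a ha)) v s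

theorem EFib.opA_pow_mk {c : Conf V U r} (a : ConfTilde V U r) (ha : Conf.mk a = c) (n : ℕ)
    (v : Fin r → ℂ) : (EFib.opA c ^ n) (EFib.mk a ha v) = EFib.mk a ha ((a.1.1 ^ n).mulVec v) := by
  induction n with
  | zero => simp
  | succ n ih =>
    rw [pow_succ', Module.End.mul_apply, ih, EFib.opA_mk, Matrix.mulVec_mulVec, ← pow_succ']

theorem EFib.piMap_eq {c : Conf V U r} (a : ConfTilde V U r) (ha : Conf.mk a = c)
    (v : Fin r → V) : EFib.piMap c v = EFib.mk a ha (ConfTilde.piMap a v) := by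
  rw [ConfTilde.piMap_apply, EFib.mk_sum, EFib.piMap, LinearMap.sum_apply]
  refine Finset.sum_congr rfl fun i _ => ?_
  rw [← EFib.opA_pow_mk, ← EFib.iota_eq]
  rfl

variable (k : (Fin r → ℂ) →L[ℂ] (Fin r → V))

/-- The matrix of `∑ A^i ι ∘ k : ℂ^r → ℂ^r`. -/
def frameMatrix (a : ConfTilde V U r) : Matrix (Fin r) (Fin r) ℂ :=
  LinearMap.toMatrix' (ConfTilde.piMap a ∘ₗ (k : (Fin r → ℂ) →ₗ[ℂ] (Fin r → V)))

theorem frameMatrix_mulVec (a : ConfTilde V U r) (v : Fin r → ℂ) :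
    (frameMatrix k a).mulVec v = ConfTilde.piMap a (k v) :=
  LinearMap.toMatrix'_mulVec _ v

theorem continuous_frameMatrix : Continuous fun a : ConfTilde V U r => frameMatrix k a := by
  refine continuous_pi fun i => continuous_pi fun j => ?_
  have : Continuous fun a : ConfTilde V U r => ConfTilde.piMap a (k (Pi.single j 1)) :=
    ConfTilde.continuous_piMap continuous_id continuous_const
  refine ((continuous_apply i).comp this).congr fun a => ?_
  rw [Function.comp_apply, ← frameMatrix_mulVec]
  simp

/-- By this equivariance, invertibility of the frame matrix depends only on the orbit, and the
coordinates `M⁻¹ v` are invariant. -/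
theorem MovesTo.frameMatrix {g : GL (Fin r) ℂ} {a b : ConfTilde V U r} (h : MovesTo g a b) :
    frameMatrix k b = g * frameMatrix k a := by
  apply Matrix.ext_of_mulVec_single
  intro j
  rw [← Matrix.mulVec_mulVec, frameMatrix_mulVec, frameMatrix_mulVec, h.piMap]

/-- The configurations for which `∑ A^i ι ∘ k` is invertible. -/
def frameBase : Set (Conf V U r) :=
  {c | Quotient.lift (fun a => IsUnit (BottConf.frameMatrix k a).det) (by
    rintro a b ⟨g, h⟩
    rw [h.frameMatrix k, Matrix.det_mul, IsUnit.mul_iff]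
    exact propext (and_iff_right ((Matrix.isUnit_iff_isUnit_det _).mp g.isUnit)).symm) c}

theorem mk_mem_frameBase (a : ConfTilde V U r) :
    Conf.mk a ∈ frameBase k ↔ IsUnit (frameMatrix k a).det := Iff.rfl

theorem isOpen_frameBase : IsOpen (frameBase k : Set (Conf V U r)) := by
  rw [← isQuotientMap_quotient_mk'.isOpen_preimage]
  have : (Quotient.mk' : ConfTilde V U r → Conf V U r) ⁻¹' frameBase k =
      {a | (frameMatrix k a).det ≠ 0} := Set.ext fun a => isUnit_iff_ne_zero
  rw [this]
  exact isOpen_ne_fun (continuous_frameMatrix k).matrix_det continuous_const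

/-- The coordinates in the frame `∑ A^i ι ∘ k`. -/
def frameCoord : Assoc V U r → (Fin r → ℂ) :=
  Quotient.lift (fun x => (frameMatrix k x.1)⁻¹.mulVec x.2) (by
    rintro ⟨a, v⟩ ⟨b, w⟩ ⟨g, h, h'⟩
    dsimp only at h h' ⊢
    rw [h', h.frameMatrix k, Matrix.mul_inv_rev, Matrix.mulVec_mulVec, mul_assoc,
      ← Matrix.coe_units_inv, Units.inv_mul, mul_one])

theorem Assoc.continuous_proj : Continuous (Assoc.proj : Assoc V U r → Conf V U r) :=
  continuous_quot_lift _ (continuous_quotient_mk'.comp continuous_fst)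

theorem continuousOn_frameCoord :
    ContinuousOn (frameCoord k : Assoc V U r → _) (Assoc.proj ⁻¹' frameBase k) := by
  have hq : Topology.IsQuotientMap (Quotient.mk' : ConfTilde V U r × (Fin r → ℂ) → Assoc V U r) :=
    isQuotientMap_quotient_mk'
  rw [hq.continuousOn_isOpen_iff ((isOpen_frameBase k).preimage Assoc.continuous_proj)]
  intro x hx
  have hx' : IsUnit (frameMatrix k x.1).det := hx
  have h2 : Continuous fun x : ConfTilde V U r × (Fin r → ℂ) => frameMatrix k x.1 :=
    (continuous_frameMatrix k).comp continuous_fst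
  have h1 : ContinuousAt (fun x : ConfTilde V U r × (Fin r → ℂ) => (frameMatrix k x.1)⁻¹) x := by
    simp only [Matrix.inv_def, Ring.inverse_eq_inv']
    exact (h2.matrix_det.continuousAt.inv₀ hx'.ne_zero).smul h2.matrix_adjugate.continuousAt
  have h3 : ContinuousAt (fun x : ConfTilde V U r × (Fin r → ℂ) =>
      (frameMatrix k x.1)⁻¹.mulVec x.2) x := by
    refine continuousAt_pi.mpr fun i => ?_
    simp only [Matrix.mulVec, dotProduct]
    refine tendsto_finsetSum _ fun j _ => ?_
    exact (((continuous_apply j).comp (continuous_apply i)).continuousAt.comp h1).mul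
      (((continuous_apply j).comp continuous_snd).continuousAt)
  exact h3.continuousWithinAt

/-- The coordinates in the frame `∑ A^i ι ∘ k` on a fiber. -/
def frameCoordFib (c : Conf V U r) : EFib V U r c →ₗ[ℂ] (Fin r → ℂ) where
  toFun e := frameCoord k e.1
  map_add' e₁ e₂ := by
    obtain ⟨v, rfl⟩ := EFib.exists_mk c.out c.mk_out e₁
    obtain ⟨w, rfl⟩ := EFib.exists_mk c.out c.mk_out e₂
    rw [← EFib.mk_add]
    exact Matrix.mulVec_add _ v w
  map_smul' t e := by
    obtain ⟨v, rfl⟩ := EFib.exists_mk c.out c.mk_out e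
    rw [← EFib.mk_smul]
    exact Matrix.mulVec_smul _ t v

theorem frameCoordFib_mk {c : Conf V U r} (a : ConfTilde V U r) (ha : Conf.mk a = c)
    (v : Fin r → ℂ) : frameCoordFib k c (EFib.mk a ha v) = (frameMatrix k a)⁻¹.mulVec v := rfl

/-- Continuity is checked upstairs, on configurations times `ℂ^r`. The product of a quotient map
with the identity need not be a quotient map, so the orbit map is first shown to be open. -/
theorem continuous_assoc_piMap :
    Continuous fun y : Conf V U r × (Fin r → ℂ) => (EFib.piMap y.1 (k y.2)).1 := by
  have hq : IsOpenQuotientMap (Quotient.mk' : ConfTilde V U r → Conf V U r) := by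
    refine ⟨Quotient.mk'_surjective, continuous_quotient_mk', fun s hs => ?_⟩
    rw [← isQuotientMap_quotient_mk'.isOpen_preimage]
    -- With the action valued in the ambient space, the saturation of an open set is the union over
    -- `g` of its preimages under `act g`.
    let act : GL (Fin r) ℂ → ConfTilde V U r → Matrix (Fin r) (Fin r) ℂ × (V →L[ℂ] (Fin r → ℂ)) :=
      fun g a => ((g : Matrix (Fin r) (Fin r) ℂ) * a.1.1 * ((g⁻¹ : GL (Fin r) ℂ) : Matrix _ _ ℂ),
        (Matrix.mulVecLin (g : Matrix (Fin r) (Fin r) ℂ)).toContinuousLinearMap ∘L a.1.2)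
    obtain ⟨t, ht, rfl⟩ := isOpen_induced_iff.mp hs
    have : (Quotient.mk' : ConfTilde V U r → Conf V U r) ⁻¹'
        (Quotient.mk' '' (Subtype.val ⁻¹' t)) = ⋃ g, act g ⁻¹' t := by
      ext b
      simp only [Set.mem_preimage, Set.mem_image, Set.mem_iUnion]
      constructor
      · rintro ⟨a, ha, hab⟩
        obtain ⟨g, h⟩ := (Quotient.exact hab : a ≈ b)
        refine ⟨g⁻¹, ?_⟩
        have : act g⁻¹ b = a.1 := by
          refine Prod.ext h.symm.1.symm ?_
          ext v : 1
          exact (h.symm.2 v).symm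
        rwa [this]
      · rintro ⟨g, hg⟩
        have hmem : spectrum ℂ (act g b).1 ⊆ U ∧ Function.Surjective (fun v : Fin r → V =>
            ∑ i : Fin r, ((act g b).1 ^ (i : ℕ)).mulVec ((act g b).2 (v i))) := by
          constructor
          · refine (spectrum.units_conjugate (a := b.1.1) (u := g)).trans_subset b.2.1
          · have hp : ∀ i : ℕ, (act g b).1 ^ i * g = g * b.1.1 ^ i := fun i =>
              ((show SemiconjBy (g : Matrix (Fin r) (Fin r) ℂ) b.1.1 (act g b).1 by
                change _ = _
                simp only [act, mul_assoc, Units.inv_mul, mul_one]).pow_right i).eq.symm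
            intro y
            obtain ⟨v, hv⟩ := b.2.2 (((g⁻¹ : GL (Fin r) ℂ) : Matrix _ _ ℂ).mulVec y)
            refine ⟨v, ?_⟩
            have h1 := congrArg (g : Matrix (Fin r) (Fin r) ℂ).mulVec hv
            rw [Matrix.mulVec_mulVec, Units.mul_inv, Matrix.one_mulVec] at h1
            rw [← h1]
            dsimp only
            rw [Matrix.mulVec_sum]
            refine Finset.sum_congr rfl fun i _ => ?_
            rw [Matrix.mulVec_mulVec, ← hp, ← Matrix.mulVec_mulVec]
            rfl
        exact ⟨⟨act g b, hmem⟩, hg, Eq.symm (Quotient.sound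
          (show b ≈ (⟨act g b, hmem⟩ : ConfTilde V U r) from ⟨g, rfl, fun v => rfl⟩))⟩
    rw [this]
    refine isOpen_iUnion fun g => ht.preimage ?_
    refine Continuous.prodMk ?_ ?_
    · exact (continuous_const.mul continuous_subtype_val.fst).mul continuous_const
    · exact continuous_const.clm_comp continuous_subtype_val.snd
  have hq2 := (hq.prodMap (IsOpenQuotientMap.id (X := Fin r → ℂ))).isQuotientMap
  rw [hq2.continuous_iff]
  have : (fun y : Conf V U r × (Fin r → ℂ) => (EFib.piMap y.1 (k y.2)).1) ∘
      Prod.map Quotient.mk' id =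
      fun x : ConfTilde V U r × (Fin r → ℂ) => Assoc.mk x.1 (ConfTilde.piMap x.1 (k x.2)) := by
    ext1 x
    exact congrArg Subtype.val (EFib.piMap_eq x.1 rfl (k x.2))
  rw [this]
  exact continuous_quotient_mk'.comp (continuous_fst.prodMk
    (ConfTilde.continuous_piMap continuous_fst (k.continuous.comp continuous_snd)))

theorem continuous_frame_totalSpace :
    Continuous fun y : Conf V U r × (Fin r → ℂ) =>
      (⟨y.1, EFib.piMap y.1 (k y.2)⟩ : TotalSpace (Fin r → ℂ) (EFib V U r)) :=
  continuous_induced_rng.mpr (continuous_assoc_piMap k)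

theorem EFib.continuous_totalSpace_val :
    Continuous fun z : TotalSpace (Fin r → ℂ) (EFib V U r) => (z.2.1 : Assoc V U r) :=
  continuous_induced_dom

theorem EFib.continuous_proj : Continuous (π (Fin r → ℂ) (EFib V U r)) := by
  have : (π (Fin r → ℂ) (EFib V U r)) = fun z => Assoc.proj z.2.1 := by
    ext1 z
    exact z.2.2.symm
  rw [this]
  exact Assoc.continuous_proj.comp EFib.continuous_totalSpace_val

/-- The local frame `∑ A^i ι ∘ k` of the global section bundle. -/
def efibFrame : LocalFrame (Fin r → ℂ) (EFib V U r) where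
  base := frameBase k
  isOpen_base := isOpen_frameBase k
  coord := frameCoordFib k
  frame c := EFib.piMap c ∘ₗ (k : (Fin r → ℂ) →ₗ[ℂ] (Fin r → V))
  coord_frame c hc v := by
    have ha : IsUnit (frameMatrix k c.out).det := by
      rwa [← mk_mem_frameBase, c.mk_out]
    change frameCoordFib k c (EFib.piMap c (k v)) = v
    rw [EFib.piMap_eq c.out c.mk_out, frameCoordFib_mk, ← frameMatrix_mulVec,
      Matrix.mulVec_mulVec, Matrix.nonsing_inv_mul _ ha, Matrix.one_mulVec]
  frame_coord c hc e := by
    have ha : IsUnit (frameMatrix k c.out).det := by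
      rwa [← mk_mem_frameBase, c.mk_out]
    obtain ⟨w, rfl⟩ := EFib.exists_mk c.out c.mk_out e
    change EFib.piMap c (k (frameCoordFib k c (EFib.mk c.out c.mk_out w))) = _
    rw [EFib.piMap_eq c.out c.mk_out, frameCoordFib_mk, ← frameMatrix_mulVec,
      Matrix.mulVec_mulVec, Matrix.mul_nonsing_inv _ ha, Matrix.one_mulVec]
  continuousOn_coord := (continuousOn_frameCoord k).comp
    EFib.continuous_totalSpace_val.continuousOn fun z hz => by
      rw [Set.mem_preimage, z.2.2]
      exact hz
  continuousOn_frame := (continuous_frame_totalSpace k).continuousOn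
  continuous_coord c hc := (continuousOn_frameCoord k).comp_continuous continuous_subtype_val
    fun e => by
      rw [Set.mem_preimage, e.2]
      exact hc
  continuous_frame c hc := continuous_induced_rng.mpr
    ((continuous_assoc_piMap k).comp (Continuous.prodMk_right c))

/-- For `k` a right inverse of `∑ A^i ι` at one representative, the frame matrix there is the
identity. -/
theorem exists_efibFrame (c : Conf V U r) :
    ∃ k : (Fin r → ℂ) →L[ℂ] (Fin r → V), c ∈ (efibFrame (U := U) k).base := by
  have hs : Function.Surjective (ConfTilde.piMap c.out) := fun y => by
    obtain ⟨v, hv⟩ := c.out.2.2 y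
    exact ⟨v, (ConfTilde.piMap_apply _ _).trans hv⟩
  obtain ⟨k, hk⟩ := LinearMap.exists_rightInverse_of_surjective _ (LinearMap.range_eq_top.mpr hs)
  refine ⟨LinearMap.toContinuousLinearMap k, ?_⟩
  have h1 : frameMatrix (LinearMap.toContinuousLinearMap k) c.out = 1 := by
    rw [frameMatrix, ← LinearMap.toMatrix'_id]
    exact congrArg _ hk
  change c ∈ frameBase _
  rw [← c.mk_out, mk_mem_frameBase, h1, Matrix.det_one]
  exact isUnit_one

theorem isVectorBundle_EFib : IsVectorBundle (Fin r → ℂ) (EFib V U r) :=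
  isVectorBundle_of_localFrames EFib.continuous_proj fun c =>
    (exists_efibFrame c).imp' efibFrame fun _ h => h

end GlobalSectionBundle

/-! ### The cokernel bundle and its isomorphism with the pullback -/

section CokernelIso

variable {V : Type*} [NormedAddCommGroup V] [NormedSpace ℂ V] [FiniteDimensional ℂ V] {l r : ℕ}

/-- One presentation defines the map on `l²`, and its kernel is the range of the Toeplitz operator.
The formula then holds for every presentation, since two of them differ by an element of `GL_r`. -/
theorem exists_cokerEquiv (p : PolyS1 V l r) :
    ∃ Φ : TCoker p.1 ≃ₗ[ℂ] EFib V disk r (confDisk p),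
      ∀ (φ : H0 p.1 ≃ₗ[ℂ] (Fin r → ℂ)) (a : ConfTilde V disk r) (ha : Conf.mk a = confDisk p),
        Presents p.1 φ a → ∀ s, Φ (toTCoker p.1 s) = EFib.mk a ha (φ (hardyToH0 p.1 s)) := by
  obtain ⟨φ₀, a₀, h₀, ha₀⟩ := isConfOf_confDisk p
  let G : L2 V →ₗ[ℂ] EFib V disk r (confDisk p) :=
    { toFun := fun s => EFib.mk a₀ ha₀ (φ₀ (hardyToH0 p.1 s))
      map_add' := fun s t => by rw [map_add, map_add, EFib.mk_add]
      map_smul' := fun c s => by rw [map_smul, map_smul, EFib.mk_smul]; rfl }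
  have hG : ∀ s, G s = EFib.mk a₀ ha₀ (φ₀ (hardyToH0 p.1 s)) := fun s => rfl
  have hs : Function.Surjective G := fun e => by
    obtain ⟨y, rfl⟩ := EFib.exists_mk a₀ ha₀ e
    obtain ⟨s, -, hs⟩ := exists_polySeq_hardyToH0 p (φ₀.symm y)
    exact ⟨s, by rw [hG, hs, φ₀.apply_symm_apply]⟩
  have hk : (toeplitz p.1).range = LinearMap.ker G := by
    rw [← ker_hardyToH0]
    ext s
    rw [LinearMap.mem_ker, LinearMap.mem_ker, hG]
    constructor
    · intro h
      rw [h, map_zero, ← map_zero φ₀, ← map_zero (hardyToH0 p.1)]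
      exact map_zero G
    · intro h
      have h1 : EFib.mk a₀ ha₀ (φ₀ (hardyToH0 p.1 s)) = EFib.mk a₀ ha₀ (φ₀ (hardyToH0 p.1 0)) :=
        h.trans (map_zero G).symm
      have h2 := (EFib.equiv a₀ ha₀).injective h1
      rw [φ₀.injective h2, map_zero]
  refine ⟨(Submodule.quotEquivOfEq _ _ hk).trans (G.quotKerEquivOfSurjective hs),
    fun φ a ha h s => ?_⟩
  obtain ⟨g, hg, hφ⟩ := h₀.exists_movesTo h
  change EFib.mk a₀ ha₀ (φ₀ (hardyToH0 p.1 s)) = _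
  rw [hφ]
  exact Subtype.ext (Quotient.sound ⟨g, hg, rfl⟩)

/-- The isomorphism from the cokernel of the Toeplitz operator to the fiber of the global section
bundle. -/
def cokerEquiv (p : PolyS1 V l r) : TCoker p.1 ≃ₗ[ℂ] EFib V disk r (confDisk p) :=
  (exists_cokerEquiv p).choose

theorem cokerEquiv_apply {p : PolyS1 V l r} {φ : H0 p.1 ≃ₗ[ℂ] (Fin r → ℂ)}
    {a : ConfTilde V disk r} (ha : Conf.mk a = confDisk p) (h : Presents p.1 φ a) (s : L2 V) :
    cokerEquiv p (toTCoker p.1 s) = EFib.mk a ha (φ (hardyToH0 p.1 s)) :=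
  (exists_cokerEquiv p).choose_spec φ a ha h s

theorem cokerEquiv_inclL2 (p : PolyS1 V l r) (v : Fin r → V) :
    cokerEquiv p (toTCoker p.1 (inclL2 v)) = EFib.piMap (confDisk p) v := by
  obtain ⟨φ, a, h, ha⟩ := isConfOf_confDisk p
  rw [cokerEquiv_apply ha h, EFib.piMap_eq a ha, ConfTilde.piMap_apply, hardyToH0_inclL2, map_sum]
  congr 1
  refine Finset.sum_congr rfl fun i _ => ?_
  rw [h.2]
  generalize toH0 p.1 (constHol V (v i)) = σ
  induction (i : ℕ) generalizing σ with
  | zero => simp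
  | succ n ih => rw [pow_succ, pow_succ, Module.End.mul_apply, ih, h.1, Matrix.mulVec_mulVec]

theorem exists_toTCoker_inclL2 (p : PolyS1 V l r) (s : L2 V) :
    ∃ v : Fin r → V, toTCoker p.1 (inclL2 v) = toTCoker p.1 s := by
  obtain ⟨v, hv⟩ := exists_hardyToH0_inclL2_eq p (hardyToH0 p.1 s)
  obtain ⟨φ, a, h, ha⟩ := isConfOf_confDisk p
  exact ⟨v, (cokerEquiv p).injective (by rw [cokerEquiv_apply ha h, cokerEquiv_apply ha h, hv])⟩

/-- Through a local lift the map reads `(p, s) ↦ [a p, β_p s]`. -/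
theorem continuous_cokerEquiv_toTCoker :
    Continuous fun y : PolyS1 V l r × L2 V => (cokerEquiv y.1 (toTCoker y.1.1 y.2)).1 := by
  rw [continuous_iff_continuousAt]
  rintro ⟨p₀, s₀⟩
  obtain ⟨k, U, β, φ, a, hU, h0, hβ, ha, h⟩ := exists_local_lift p₀
  refine ContinuousOn.continuousAt (s := U ×ˢ Set.univ) ?_
    ((hU.prod isOpen_univ).mem_nhds ⟨h0, Set.mem_univ _⟩)
  rw [continuousOn_iff_continuous_domRestrict]
  let q : ↑(U ×ˢ (Set.univ : Set (L2 V))) → U := fun y => ⟨y.1.1, y.2.1⟩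
  have hq : Continuous q :=
    (continuous_fst.comp continuous_subtype_val).subtype_mk fun y => y.2.1
  have e : (U ×ˢ (Set.univ : Set (L2 V))).domRestrict
      (fun y : PolyS1 V l r × L2 V => (cokerEquiv y.1 (toTCoker y.1.1 y.2)).1) =
      fun y => Assoc.mk (a (q y)) (β (q y) y.1.2) := by
    ext1 y
    have h1 := h (q y)
    change (cokerEquiv (q y).1 (toTCoker (q y).1.1 y.1.2)).1 = _
    rw [cokerEquiv_apply h1.1.mk_eq_confDisk h1.1, h1.2.1]
    rfl
  rw [e]
  exact continuous_quotient_mk'.comp ((ha.comp hq).prodMk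
    ((hβ.comp hq).clm_apply (continuous_snd.comp continuous_subtype_val)))

theorem Continuous.cokerEquiv_toTCoker {Y : Type*} [TopologicalSpace Y] {p : Y → PolyS1 V l r}
    {s : Y → L2 V} (hp : Continuous p) (hs : Continuous s) :
    Continuous fun y => (cokerEquiv (p y) (toTCoker (p y).1 (s y))).1 := by
  have h := continuous_cokerEquiv_toTCoker.comp (hp.prodMk hs)
  exact h

variable {X : Type*} [TopologicalSpace X]

theorem CokerBundle.isQuotientMap_mk (f : X → PolyS1 V l r) :
    Topology.IsQuotientMap (fun y : X × L2 V =>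
      (⟨y.1, CokerBundle.mk f y.1 y.2⟩ : TotalSpace (Fin r → ℂ) (CokerBundle f))) :=
  ⟨⟨rfl⟩, fun ⟨x, z⟩ => by
    obtain ⟨s, rfl⟩ := Submodule.mkQ_surjective _ z
    exact ⟨(x, s), rfl⟩⟩

theorem CokerBundle.continuous_proj (f : X → PolyS1 V l r) :
    Continuous (π (Fin r → ℂ) (CokerBundle f)) :=
  (CokerBundle.isQuotientMap_mk f).continuous_iff.mpr continuous_fst

/-- The isomorphism between the two families of vector spaces over `x`. -/
def cokerBundleEquiv (f : X → PolyS1 V l r) (x : X) : CokerBundle f x ≃ₗ[ℂ] Bun f x :=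
  cokerEquiv (f x)

theorem continuous_cokerBundleEquiv (f : C(X, PolyS1 V l r)) :
    Continuous fun z : TotalSpace (Fin r → ℂ) (CokerBundle f) =>
      ((cokerBundleEquiv f z.1 z.2 : EFib V disk r (confDisk (f z.1))).1 : Assoc V disk r) :=
  (CokerBundle.isQuotientMap_mk f).continuous_iff.mpr
    (Continuous.cokerEquiv_toTCoker (f.continuous.comp continuous_fst) continuous_snd)

theorem CokerBundle.continuous_frame (f : X → PolyS1 V l r)
    (k : (Fin r → ℂ) →L[ℂ] (Fin r → V)) :
    Continuous fun y : X × (Fin r → ℂ) =>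
      (⟨y.1, CokerBundle.mk f y.1 (inclL2 (k y.2))⟩ :
        TotalSpace (Fin r → ℂ) (CokerBundle f)) := by
  simp only [← inclCLM_apply]
  exact (CokerBundle.isQuotientMap_mk f).continuous.comp (continuous_fst.prodMk
    (((inclCLM V r).continuous.comp k.continuous).comp continuous_snd))

/-- The coordinates on the fibers of the cokernel bundle given by `k : ℂ^r → V^r`. -/
def cokerCoord (f : X → PolyS1 V l r) (k : (Fin r → ℂ) →L[ℂ] (Fin r → V)) (x : X) :
    CokerBundle f x →ₗ[ℂ] (Fin r → ℂ) :=
  (frameCoordFib k (confDisk (f x)) ∘ₗ (cokerEquiv (f x)).toLinearMap :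
    TCoker (f x).1 →ₗ[ℂ] (Fin r → ℂ))

/-- The local frame of the cokernel bundle given by `k : ℂ^r → V^r`. -/
def cokerFrame (f : C(X, PolyS1 V l r)) (k : (Fin r → ℂ) →L[ℂ] (Fin r → V)) :
    LocalFrame (Fin r → ℂ) (CokerBundle f) where
  base := (fun x => confDisk (f x)) ⁻¹' frameBase k
  isOpen_base := (isOpen_frameBase k).preimage (continuous_confDisk.comp f.continuous)
  coord := cokerCoord f k
  frame x := CokerBundle.mk f x ∘ₗ
    ((inclCLM V r ∘L k : (Fin r → ℂ) →L[ℂ] L2 V) : (Fin r → ℂ) →ₗ[ℂ] L2 V)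
  coord_frame x hx v := by
    change frameCoordFib k (confDisk (f x))
      (cokerEquiv (f x) (toTCoker (f x).1 (inclCLM V r (k v)))) = v
    rw [inclCLM_apply, cokerEquiv_inclL2]
    exact (efibFrame k).coord_frame _ hx v
  frame_coord x hx y := by
    apply (cokerEquiv (f x)).injective
    change cokerEquiv (f x) (toTCoker (f x).1 (inclCLM V r (k _))) = _
    rw [inclCLM_apply, cokerEquiv_inclL2]
    exact (efibFrame k).frame_coord _ hx (cokerEquiv (f x) y)
  continuousOn_coord := by
    have h := (continuousOn_frameCoord k).comp (continuous_cokerBundleEquiv f).continuousOn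
      (s := {z | confDisk (f z.1) ∈ frameBase k}) fun z hz =>
        (congrArg (· ∈ frameBase k)
          (cokerBundleEquiv f z.1 z.2 : EFib V disk r (confDisk (f z.1))).2).mpr hz
    exact h
  continuousOn_frame := by
    have h := (CokerBundle.continuous_frame f k).continuousOn
      (s := ((fun x => confDisk (f x)) ⁻¹' frameBase k) ×ˢ Set.univ)
    simp only [← inclCLM_apply] at h
    exact h
  continuous_coord x hx := by
    have h1 : Continuous fun z : TCoker (f x).1 => (cokerEquiv (f x) z).1 :=
      (toeplitz (f x).1).range.isQuotientMap_mkQ.continuous_iff.mpr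
        (Continuous.cokerEquiv_toTCoker continuous_const continuous_id)
    have h2 := (continuousOn_frameCoord k).comp_continuous h1 fun z => by
      rw [Set.mem_preimage, (cokerEquiv (f x) z).2]
      exact hx
    exact h2
  continuous_frame x hx := by
    have h : Continuous fun s : L2 V => toTCoker (f x).1 s := continuous_quotient_mk'
    exact h.comp (inclCLM V r ∘L k).continuous

theorem isVectorBundle_cokerBundle (f : C(X, PolyS1 V l r)) :
    IsVectorBundle (Fin r → ℂ) (CokerBundle f) :=
  isVectorBundle_of_localFrames (CokerBundle.continuous_proj f) fun x =>
    (exists_efibFrame (confDisk (f x))).imp' (cokerFrame f) fun _ h => h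

theorem isVectorBundle_bun (f : C(X, PolyS1 V l r)) : IsVectorBundle (Fin r → ℂ) (Bun f) := by
  obtain ⟨fb, vb⟩ := isVectorBundle_EFib (V := V) (U := disk) (r := r)
  let F : C(X, Conf V disk r) := ⟨fun x => confDisk (f x), continuous_confDisk.comp f.continuous⟩
  exact ⟨FiberBundle.pullback F, VectorBundle.pullback ℂ F⟩

/-- The isomorphism from the cokernel bundle to `Bun_X(V, f)`. -/
def cokerBundleIso (f : C(X, PolyS1 V l r)) :
    BundleIso (Fin r → ℂ) (CokerBundle f) (Bun f) where
  fib := cokerBundleEquiv f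
  continuous_toFun := by
    rw [(inducing_pullbackTotalSpaceEmbedding (Fin r → ℂ) (EFib V disk r)
      fun x => confDisk (f x)).continuous_iff]
    exact (CokerBundle.continuous_proj f).prodMk
      (continuous_induced_rng.mpr (continuous_cokerBundleEquiv f))
  continuous_invFun := by
    have hp := Pullback.continuous_proj (Fin r → ℂ) (EFib V disk r) fun x => confDisk (f x)
    have hl := EFib.continuous_totalSpace_val.comp
      (Pullback.continuous_lift (Fin r → ℂ) (EFib V disk r) fun x => confDisk (f x))
    rw [continuous_iff_continuousAt]
    intro z₀
    obtain ⟨k, hk⟩ := exists_efibFrame (confDisk (f z₀.1))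
    let N : Set (TotalSpace (Fin r → ℂ) (Bun f)) :=
      {z | confDisk (f z.1) ∈ frameBase k}
    have hN : IsOpen N := (isOpen_frameBase k).preimage
      ((continuous_confDisk.comp f.continuous).comp hp)
    refine ContinuousOn.continuousAt (s := N) ?_ (hN.mem_nhds hk)
    have h1 : ContinuousOn (fun z : TotalSpace (Fin r → ℂ) (Bun f) =>
        frameCoord k (z.2 : EFib V disk r (confDisk (f z.1))).1) N :=
      (continuousOn_frameCoord k).comp hl.continuousOn fun z hz => by
        rw [Set.mem_preimage]
        exact (congrArg (· ∈ frameBase k) (z.2 : EFib V disk r (confDisk (f z.1))).2).mpr hz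
    refine ((CokerBundle.continuous_frame f k).comp_continuousOn
      (hp.continuousOn.prodMk h1)).congr fun z hz => ?_
    -- Over `N` the inverse is explicit: take the coordinates in the frame given by `k`, and use
    -- them in the corresponding frame of the cokernel bundle.
    have h2 : (cokerBundleEquiv f z.1).symm z.2 =
        CokerBundle.mk f z.1 (inclL2 (k (frameCoordFib k (confDisk (f z.1)) z.2))) := by
      rw [LinearEquiv.symm_apply_eq]
      exact (((cokerEquiv_inclL2 (f z.1) _).trans
        ((efibFrame k).frame_coord (confDisk (f z.1)) hz z.2))).symm
    exact congrArg (TotalSpace.mk z.1) h2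

/-- Every cokernel class has a representative in `V^r`, so compatibility fixes the map on each
fiber. The result depends only on the point `f x`; this gives both uniqueness and base change. -/
theorem bundleIso_fib_mk_eq {f : C(X, PolyS1 V l r)}
    {Φ : BundleIso (Fin r → ℂ) (CokerBundle f) (Bun f)}
    (h : ∀ (x : X) (v : Fin r → V), Φ.fib x (CokerBundle.mk f x (inclL2 v)) = Bun.piMap f x v)
    (x : X) (s : L2 V) : Φ.fib x (CokerBundle.mk f x s) = cokerEquiv (f x) (toTCoker (f x).1 s) := by
  obtain ⟨v, hv⟩ := exists_toTCoker_inclL2 (f x) s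
  have h1 : CokerBundle.mk f x s = CokerBundle.mk f x (inclL2 v) := hv.symm
  rw [h1, h, ← hv, cokerEquiv_inclL2]
  rfl

theorem BundleIso.ext_fib {B F : Type*} {E₁ E₂ : B → Type*} [TopologicalSpace B]
    [∀ x, AddCommMonoid (E₁ x)] [∀ x, Module ℂ (E₁ x)] [TopologicalSpace (TotalSpace F E₁)]
    [∀ x, AddCommMonoid (E₂ x)] [∀ x, Module ℂ (E₂ x)] [TopologicalSpace (TotalSpace F E₂)]
    {Φ Ψ : BundleIso F E₁ E₂} (h : ∀ x y, Φ.fib x y = Ψ.fib x y) : Φ = Ψ := by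
  cases Φ
  cases Ψ
  congr
  ext x y
  exact h x y

end CokernelIso

end BottConf

end

open BottConf in
theorem mainTheorem6 {V : Type*} [NormedAddCommGroup V] [NormedSpace ℂ V] [FiniteDimensional ℂ V]
    (l r : ℕ) :
    -- the configuration map is well defined and continuous
    (∀ (p : PolyS1 V l r) (c : Conf V disk r), IsConfOf p.1 c ↔ c = confDisk p) ∧
    Continuous (confDisk : PolyS1 V l r → Conf V disk r) ∧
    ∀ {X : Type*} [TopologicalSpace X] (f : C(X, PolyS1 V l r)),
      IsVectorBundle (Fin r → ℂ) (CokerBundle f) ∧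
      IsVectorBundle (Fin r → ℂ) (Bun f) ∧
      ∃ Φ : BundleIso (Fin r → ℂ) (CokerBundle f) (Bun f),
        -- compatibility with the canonical maps from the trivial bundle `V^r`
        (∀ (x : X) (v : Fin r → V), Φ.fib x (CokerBundle.mk f x (inclL2 v)) = Bun.piMap f x v) ∧
        -- this compatibility determines the isomorphism
        (∀ Φ' : BundleIso (Fin r → ℂ) (CokerBundle f) (Bun f),
          (∀ (x : X) (v : Fin r → V),
            Φ'.fib x (CokerBundle.mk f x (inclL2 v)) = Bun.piMap f x v) → Φ' = Φ) ∧
        -- on fibers it sends the class of `s` to the class of the holomorphic function `∑ s_n z^n`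
        (∀ (x : X) (φ : H0 (f x).1 ≃ₗ[ℂ] (Fin r → ℂ)) (a : ConfTilde V disk r)
          (ha : Conf.mk a = confDisk (f x)), Presents (f x).1 φ a → ∀ s : L2 V,
            Φ.fib x (CokerBundle.mk f x s) = EFib.mk a ha (φ (toH0 (f x).1 (hardy s)))) ∧
        -- compatibility with base change
        (∀ {Y : Type*} [TopologicalSpace Y] (g : C(Y, X))
          (Ψ : BundleIso (Fin r → ℂ) (CokerBundle (f.comp g)) (Bun (f.comp g))),
          (∀ (y : Y) (v : Fin r → V),
            Ψ.fib y (CokerBundle.mk (f.comp g) y (inclL2 v)) = Bun.piMap (f.comp g) y v) →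
          ∀ (y : Y) (s : L2 V),
            Ψ.fib y (CokerBundle.mk (f.comp g) y s) = Φ.fib (g y) (CokerBundle.mk f (g y) s)) := by
  refine ⟨isConfOf_iff, continuous_confDisk, fun f => ⟨isVectorBundle_cokerBundle f,
    isVectorBundle_bun f, cokerBundleIso f, fun x v => cokerEquiv_inclL2 (f x) v,
    fun Φ' h => BundleIso.ext_fib fun x y => ?_,
    fun x φ a ha h s => cokerEquiv_apply ha h s, fun g Ψ h y s => bundleIso_fib_mk_eq h y s⟩⟩
  obtain ⟨s, rfl⟩ := Submodule.mkQ_surjective _ y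
  exact bundleIso_fib_mk_eq h x s
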